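/- Let $\mathbb D$ be the open unit disc, $1<p<\infty$ and $\alpha>-1$. Let $X$ be either the Hardy space $H^p$ of analytic $f$ on $\mathbb D$ with $\|f\|_X=\lim_{r\to1^-}\big(\int_{\partial\mathbb D}|f(rz)|^p\,dm(z)\big)^{1/p}<\infty$, where $m$ is normalized arc length, or the weighted Bergman space $A^p_\alpha$ of analytic $f$ on $\mathbb D$ with $\|f\|_X=\big(\int_{\mathbb D}|f(z)|^p(\alpha+1)(1-|z|^2)^\alpha\,dA(z)\big)^{1/p}<\infty$, where $A$ is area measure normalized by $A(\mathbb D)=1$. For a bounded operator $S$ on $X$ put $$\mathrm{EN}(S)=\sup_{(f_n)}\limsup_{n}\|Sf_n\|_X,$$ the supremum being over all weakly null sequences $(f_n)$ in $X$ with $\|f_n\|_X=1$ for all $n$. For $g\in H^\infty$ (bounded analytic on $\mathbb D$) let $M_g f=gf$. Let $g_t\in H^\infty$, $t\in(0,1)$, be such that $\{M_{g_t}\}$ satisfies $W(X)$: for every $f\in X$ the map $t\mapsto M_{g_t}f$ is continuous from $(0,1)$ to $X$ and $\int_0^1\|M_{g_t}f\|_X\,dt<\infty$. Let $\int_0^1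 M_{g_t}\,dt$ denote the bounded operator $f\mapsto\int_0^1 M_{g_t}f\,dt$ on $X$. Then the equality $$\mathrm{EN}\Big(\int_0^1 M_{g_t}\,dt\Big)=\int_0^1\mathrm{EN}(M_{g_t})\,dt$$ (the right-hand side being an integral with values in $[0,\infty]$) holds if and only if there is a weakly null sequence $(\phi_n)$ in $X$ with $\|\phi_n\|_X=1$ for all $n$ such that (I1) the limits $\lim_n\big\|\int_0^1M_{g_t}\phi_n\,dt\big\|_X$ and $\lim_n\int_0^1\|M_{g_t}\phi_n\|_X\,dt$ exist and are equal, and (I2) $\liminf_n\|M_{g_t}\phi_n\|_X=\mathrm{EN}(M_{g_t})$ for almost every $t\in(0,1)$. Moreover, if the equality holds, then $(\phi_n)$ can be chosen to be in addition an approximate evaluation map, that is, such that there is $\xi\in\partial\mathbb D$ with $\lim_n\sup\{|\phi_n(z)|: z\in\mathbb D,\ |z-\xi|\ge\varepsilon\}=0$ for every $\varepsilon>0$. -/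

import Mathlib

open MeasureTheory Filter Topology Set
open scoped ENNReal

noncomputable section

namespace DiscSpaces

/-- The open unit disc. -/
abbrev disc : Set ℂ := Metric.ball 0 1

/-- The analytic functions on the unit disc. An analytic function `f : 𝔻 → ℂ` is represented by its
extension by zero to `ℂ`, so that two elements are equal iff they agree on the disc. -/
def holomorphic : Submodule ℂ (ℂ → ℂ) where
  carrier := {f | DifferentiableOn ℂ f disc ∧ ∀ z ∉ disc, f z = 0}
  add_mem' := fun {f g} hf hg => ⟨hf.1.add hg.1, fun z hz => by simp [hf.2 z hz, hg.2 z hz]⟩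
  zero_mem' := ⟨differentiableOn_const 0, fun _ _ => rfl⟩
  smul_mem' := fun c f hf => ⟨hf.1.const_smul c, fun z hz => by simp [hf.2 z hz]⟩

/-- The rotation-invariant probability measure on the circle `|z| = r`; integrating `F` against it
gives `∫ F (r z) dm(z)` with `m` the normalized arc length on the unit circle. -/
def circleMeasure (r : ℝ) : Measure ℂ :=
  ENNReal.ofReal (1 / (2 * Real.pi)) •
    (volume.restrict (Ioc (-Real.pi) Real.pi)).map (circleMap 0 r)

/-- The weighted area measure `dA_α = (α + 1) (1 - |z|²)^α dA` on the unit disc, where `A` is the area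
measure normalized so that the disc has area one (this is the factor `1 / π`). -/
def bergmanMeasure (α : ℝ) : Measure ℂ :=
  (volume.restrict disc).withDensity
    fun z => ENNReal.ofReal ((α + 1) / Real.pi * (1 - ‖z‖ ^ 2) ^ α)

/-- The Hardy norm `lim_{r → 1} (∫ |f (r z)|^p dm(z))^(1/p)`, possibly infinite. For analytic `f` the
integral means increase with `r`, so the limit is the supremum over `0 < r < 1`; this is proved in
`tendsto_hardyENorm` below. -/
def hardyENorm (p : ℝ) (f : ℂ → ℂ) : ℝ≥0∞ :=
  ⨆ r ∈ Ioo (0 : ℝ) 1, eLpNorm f (ENNReal.ofReal p) (circleMeasure r)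

/-- The weighted Bergman norm `(∫_𝔻 |f|^p dA_α)^(1/p)`, possibly infinite. -/
def bergmanENorm (p α : ℝ) (f : ℂ → ℂ) : ℝ≥0∞ :=
  eLpNorm f (ENNReal.ofReal p) (bergmanMeasure α)

/-- The spaces under consideration: the Hardy spaces `H^p`, `1 < p < ∞`, and the weighted Bergman
spaces `A^p_α`, `1 < p < ∞`, `α > -1`. -/
inductive SpaceKind where
  | hardy (p : ℝ) (hp : 1 < p)
  | bergman (p α : ℝ) (hp : 1 < p) (hα : -1 < α)

namespace SpaceKind

/-- The exponent `p`. -/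
def expo : SpaceKind → ℝ
  | hardy p _ => p
  | bergman p _ _ _ => p

/-- The measures over which the `p`-means are taken. -/
def measures : SpaceKind → Set (Measure ℂ)
  | hardy _ _ => circleMeasure '' Ioo 0 1
  | bergman _ α _ _ => {bergmanMeasure α}

/-- The norm of `H^p` or `A^p_α`, with value `∞` outside the space. -/
def enorm : SpaceKind → (ℂ → ℂ) → ℝ≥0∞
  | hardy p _, f => hardyENorm p f
  | bergman p α _ _, f => bergmanENorm p α f

theorem one_lt_expo (s : SpaceKind) : 1 < s.expo := by
  cases s <;> simpa [expo]

theorem one_le_expo (s : SpaceKind) : 1 ≤ ENNReal.ofReal s.expo := by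
  simpa using ENNReal.ofReal_le_ofReal s.one_lt_expo.le

theorem enorm_eq (s : SpaceKind) (f : ℂ → ℂ) :
    s.enorm f = ⨆ μ ∈ s.measures, eLpNorm f (ENNReal.ofReal s.expo) μ := by
  cases s with
  | hardy p hp =>
    simp only [enorm, measures, expo, hardyENorm]
    rw [iSup_image]
  | bergman p α hp hα => simp [enorm, measures, expo, bergmanENorm]

end SpaceKind

theorem measurable_of_holomorphic {f : ℂ → ℂ} (hf : f ∈ holomorphic) : Measurable f := by
  have h1 : disc.indicator f = f := by
    ext z
    by_cases hz : z ∈ disc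
    · rw [indicator_of_mem hz]
    · rw [indicator_of_notMem hz, hf.2 z hz]
  classical
  rw [← h1, ← Set.piecewise_eq_indicator]
  exact hf.1.continuousOn.measurable_piecewise continuousOn_const measurableSet_ball

namespace SpaceKind

variable (s : SpaceKind)

theorem enorm_zero : s.enorm 0 = 0 := by
  simp [enorm_eq]

theorem enorm_add_le {f g : ℂ → ℂ} (hf : f ∈ holomorphic) (hg : g ∈ holomorphic) :
    s.enorm (f + g) ≤ s.enorm f + s.enorm g := by
  simp only [enorm_eq]
  refine iSup₂_le fun μ hμ => ?_
  refine (eLpNorm_add_le (measurable_of_holomorphic hf).aestronglyMeasurable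
    (measurable_of_holomorphic hg).aestronglyMeasurable s.one_le_expo).trans ?_
  exact add_le_add (le_iSup₂ (f := fun μ _ => eLpNorm f (ENNReal.ofReal s.expo) μ) μ hμ)
    (le_iSup₂ (f := fun μ _ => eLpNorm g (ENNReal.ofReal s.expo) μ) μ hμ)

theorem enorm_smul (c : ℂ) (f : ℂ → ℂ) : s.enorm (c • f) = ‖c‖ₑ * s.enorm f := by
  simp only [enorm_eq, eLpNorm_const_smul, ENNReal.mul_iSup]

theorem enorm_le_mul {f g : ℂ → ℂ} (c : ℝ) (h : ∀ z, ‖f z‖ ≤ c * ‖g z‖) :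
    s.enorm f ≤ ENNReal.ofReal c * s.enorm g := by
  simp only [enorm_eq, ENNReal.mul_iSup]
  exact iSup₂_mono fun μ _ => eLpNorm_le_mul_eLpNorm_of_ae_le_mul (ae_of_all _ h) _

theorem enorm_le_liminf {f : ℕ → ℂ → ℂ} (hf : ∀ n, f n ∈ holomorphic) {g : ℂ → ℂ}
    (h : ∀ z, Tendsto (fun n => f n z) atTop (𝓝 (g z))) :
    s.enorm g ≤ liminf (fun n => s.enorm (f n)) atTop := by
  rw [enorm_eq]
  refine iSup₂_le fun μ hμ => ?_
  refine (Lp.eLpNorm_lim_le_liminf_eLpNorm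
    (fun n => (measurable_of_holomorphic (hf n)).aestronglyMeasurable) g
    (ae_of_all _ h)).trans ?_
  refine liminf_le_liminf (Eventually.of_forall fun n => ?_)
  rw [enorm_eq]
  exact le_iSup₂ (f := fun μ _ => eLpNorm (f n) (ENNReal.ofReal s.expo) μ) μ hμ

end SpaceKind

theorem isProbabilityMeasure_circleMeasure (r : ℝ) : IsProbabilityMeasure (circleMeasure r) := by
  constructor
  rw [circleMeasure, Measure.smul_apply, Measure.map_apply (by fun_prop) MeasurableSet.univ]
  simp only [preimage_univ, Measure.restrict_apply_univ, Real.volume_Ioc, smul_eq_mul]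
  rw [← ENNReal.ofReal_mul (by positivity), ENNReal.ofReal_eq_one]
  field_simp
  ring

theorem lintegral_circleMeasure (r : ℝ) {F : ℂ → ℝ≥0∞} (hF : Measurable F) :
    ∫⁻ z, F z ∂(circleMeasure r) = ENNReal.ofReal (1 / (2 * Real.pi)) *
      ∫⁻ θ in Ioc (-Real.pi) Real.pi, F (circleMap 0 r θ) := by
  rw [circleMeasure, lintegral_smul_measure, lintegral_map hF (by fun_prop), smul_eq_mul]

/-- Evaluation at a point is controlled by the mean over a larger circle. -/
theorem enorm_apply_le_circle {f : ℂ → ℂ} (hf : f ∈ holomorphic) {r : ℝ} (hr1 : r < 1)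
    {w : ℂ} (hw : ‖w‖ < r) :
    ‖f w‖ₑ ≤ ENNReal.ofReal ((r + ‖w‖) / (r - ‖w‖)) * ∫⁻ z, ‖f z‖ₑ ∂(circleMeasure r) := by
  have hr : 0 < r := (norm_nonneg w).trans_lt hw
  have hd : DiffContOnCl ℂ f (Metric.ball 0 r) := by
    refine (hf.1.mono ?_).diffContOnCl
    rw [closure_ball _ hr.ne']
    exact Metric.closedBall_subset_ball hr1
  have key := hd.circleAverage_re_herglotzRieszKernel_smul' (w := w) (by simpa using hw)
  simp only [sub_zero, Real.circleAverage_def] at key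
  set G : ℝ → ℂ := fun θ =>
    ((circleMap 0 r θ + w) / (circleMap 0 r θ - w)).re • f (circleMap 0 r θ) with hG
  have hper : Function.Periodic G (2 * Real.pi) := fun θ => by
    simp only [hG, periodic_circleMap 0 r θ]
  have h2 := hper.intervalIntegral_add_eq (-Real.pi) 0
  rw [zero_add, show -Real.pi + 2 * Real.pi = Real.pi by ring] at h2
  rw [← h2, intervalIntegral.integral_of_le (by linarith [Real.pi_pos])] at key
  rw [← key, enorm_smul, lintegral_circleMeasure r (measurable_of_holomorphic hf).enorm,
    ← mul_assoc, mul_comm (ENNReal.ofReal _), mul_assoc]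
  have h3 : ‖(2 * Real.pi)⁻¹‖ₑ = ENNReal.ofReal (1 / (2 * Real.pi)) := by
    rw [Real.enorm_eq_ofReal (by positivity), one_div]
  rw [h3]
  gcongr
  refine (enorm_integral_le_lintegral_enorm _).trans ?_
  rw [← lintegral_const_mul' _ _ ENNReal.ofReal_ne_top]
  refine lintegral_mono fun θ => ?_
  rw [hG]
  simp only [enorm_smul]
  gcongr
  have hs : circleMap 0 r θ ∈ Metric.sphere (0 : ℂ) r := by
    simp [abs_of_pos hr]
  have hb : w ∈ Metric.ball (0 : ℂ) r := by simpa using hw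
  have u := re_herglotzRieszKernel_le hs hb
  have l := le_re_herglotzRieszKernel hs hb
  simp only [sub_zero] at u l
  have l0 : 0 ≤ (r - ‖w‖) / (r + ‖w‖) :=
    div_nonneg (by linarith) (by linarith [norm_nonneg w])
  rw [Real.enorm_eq_ofReal (l0.trans l)]
  exact ENNReal.ofReal_le_ofReal u

theorem enorm_apply_le_disc {ρ : ℝ} (h0 : 0 ≤ ρ)
    {R₁ R₂ : ℝ} (h1 : ρ < R₁) (h2 : R₁ < R₂) (h3 : R₂ < 1) :
    ∃ C : ℝ≥0∞, C ≠ ∞ ∧ ∀ f ∈ holomorphic, ∀ z, ‖z‖ ≤ ρ →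
      ‖f z‖ₑ ≤ C * ∫⁻ w in Metric.ball 0 R₂, ‖f w‖ₑ := by
  set K : ℝ≥0∞ := ENNReal.ofReal (2 / (R₁ - ρ)) * ENNReal.ofReal (1 / (2 * Real.pi)) with hK
  have hKt : K ≠ ∞ := ENNReal.mul_ne_top ENNReal.ofReal_ne_top ENNReal.ofReal_ne_top
  set m : ℝ≥0∞ := ENNReal.ofReal R₁ * ENNReal.ofReal (R₂ - R₁) with hm
  have hm0 : m ≠ 0 := by
    refine mul_ne_zero ?_ ?_ <;> simp only [ne_eq, ENNReal.ofReal_eq_zero, not_le] <;> linarith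
  have hmt : m ≠ ∞ := ENNReal.mul_ne_top ENNReal.ofReal_ne_top ENNReal.ofReal_ne_top
  refine ⟨m⁻¹ * K, ENNReal.mul_ne_top (ENNReal.inv_ne_top.2 hm0) hKt, fun f hf z hz => ?_⟩
  have hfm : Measurable fun w => ‖f w‖ₑ := (measurable_of_holomorphic hf).enorm
  rw [mul_assoc, ← ENNReal.mul_le_iff_le_inv hm0 hmt]
  have hpol : Continuous fun q : ℝ × ℝ => circleMap 0 q.1 q.2 := by
    unfold circleMap; fun_prop
  have hin : ∀ r ∈ Ioo R₁ R₂, ‖f z‖ₑ ≤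
      K * ∫⁻ θ in Ioo (-Real.pi) Real.pi, ‖f (circleMap 0 r θ)‖ₑ := by
    intro r hr
    have e := enorm_apply_le_circle hf (r := r) (hr.2.trans h3) (w := z) (by linarith [hr.1])
    rw [lintegral_circleMeasure r hfm, ← mul_assoc,
      ← setLIntegral_congr (Ioo_ae_eq_Ioc (a := -Real.pi) (b := Real.pi))] at e
    refine e.trans ?_
    rw [hK]
    gcongr ENNReal.ofReal (?_ / ?_) * _ * _ <;> linarith [hr.1, hr.2]
  calc m * ‖f z‖ₑ = ∫⁻ _ in Ioo R₁ R₂, ENNReal.ofReal R₁ * ‖f z‖ₑ := by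
        rw [setLIntegral_const, Real.volume_Ioo, hm]; ring
    _ ≤ ∫⁻ r in Ioo R₁ R₂, ENNReal.ofReal r *
          (K * ∫⁻ θ in Ioo (-Real.pi) Real.pi, ‖f (circleMap 0 r θ)‖ₑ) := by
        refine setLIntegral_mono' measurableSet_Ioo fun r hr => ?_
        exact mul_le_mul' (ENNReal.ofReal_le_ofReal hr.1.le) (hin r hr)
    _ = K * ∫⁻ r in Ioo R₁ R₂, ∫⁻ θ in Ioo (-Real.pi) Real.pi,
          ENNReal.ofReal r * ‖f (circleMap 0 r θ)‖ₑ := by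
        rw [← lintegral_const_mul' _ _ hKt]
        refine lintegral_congr fun r => ?_
        rw [lintegral_const_mul' _ _ ENNReal.ofReal_ne_top]
        ring
    _ = K * ∫⁻ q in Ioo R₁ R₂ ×ˢ Ioo (-Real.pi) Real.pi,
          ENNReal.ofReal q.1 * ‖f (circleMap 0 q.1 q.2)‖ₑ := by
        rw [Measure.volume_eq_prod, setLIntegral_prod]
        exact ((ENNReal.measurable_ofReal.comp measurable_fst).mul
          (hfm.comp hpol.measurable)).aemeasurable
    _ ≤ K * ∫⁻ q in polarCoord.target, ENNReal.ofReal q.1 •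
          (Metric.ball (0 : ℂ) R₂).indicator (fun w => ‖f w‖ₑ) (Complex.polarCoord.symm q) := by
        refine mul_le_mul' le_rfl ?_
        refine (setLIntegral_mono' (measurableSet_Ioo.prod measurableSet_Ioo) ?_).trans
          (lintegral_mono_set ?_)
        · intro q hq
          have hq1 : 0 < q.1 := by linarith [hq.1.1]
          have he : Complex.polarCoord.symm q = circleMap 0 q.1 q.2 := by
            rw [Complex.polarCoord_symm_apply, circleMap, Complex.exp_mul_I]
            simp
          rw [he, indicator_of_mem]
          · rfl
          · simpa [abs_of_pos hq1] using hq.1.2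
        · rw [polarCoord_target]
          refine prod_mono (fun r hr => ?_) subset_rfl
          exact (h0.trans_lt h1).trans hr.1
    _ = K * ∫⁻ w in Metric.ball 0 R₂, ‖f w‖ₑ := by
        rw [Complex.lintegral_comp_polarCoord_symm, lintegral_indicator measurableSet_ball]

theorem lintegral_periodic {g : ℝ → ℝ≥0∞} (hg : Function.Periodic g (2 * Real.pi)) (a : ℝ) :
    ∫⁻ θ in Ioc (-Real.pi) Real.pi, g (a + θ) = ∫⁻ θ in Ioc (-Real.pi) Real.pi, g θ := by
  have hpos : 0 < 2 * Real.pi := by positivity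
  have h1 : ∫⁻ θ in Ioc (-Real.pi) Real.pi, g (a + θ) =
      ∫⁻ θ in Ioc (a - Real.pi) (a - Real.pi + 2 * Real.pi), g θ := by
    have hp : (fun θ : ℝ => a + θ) ⁻¹' Ioc (a - Real.pi) (a - Real.pi + 2 * Real.pi) =
        Ioc (-Real.pi) Real.pi := by
      ext x
      simp only [mem_preimage, mem_Ioc]
      constructor <;> rintro ⟨h, h'⟩ <;> constructor <;> linarith
    rw [← (measurePreserving_add_left volume a).setLIntegral_comp_preimage_emb
      (MeasurableEquiv.addLeft a).measurableEmbedding g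
        (Ioc (a - Real.pi) (a - Real.pi + 2 * Real.pi)), hp]
  have h2 := (isAddFundamentalDomain_Ioc hpos (a - Real.pi) volume).setLIntegral_eq
    (isAddFundamentalDomain_Ioc hpos (-Real.pi) volume) g (by
      rintro ⟨_, n, rfl⟩ x
      change g (n • (2 * Real.pi) + x) = g x
      rw [add_comm]
      exact hg.zsmul n x)
  rw [h1, h2, show -Real.pi + 2 * Real.pi = Real.pi by ring]

/-- The integral means of a holomorphic function increase with the radius. -/
theorem eLpNorm_circleMeasure_mono {f : ℂ → ℂ} (hf : f ∈ holomorphic) {p : ℝ} (hp : 1 < p)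
    {r s : ℝ} (hr : 0 < r) (hrs : r < s) (hs : s < 1) :
    eLpNorm f (ENNReal.ofReal p) (circleMeasure r) ≤
      eLpNorm f (ENNReal.ofReal p) (circleMeasure s) := by
  have hs0 : 0 < s := hr.trans hrs
  have hp0 : 0 < p := by linarith
  have hp1 : 1 ≤ ENNReal.ofReal p := by simpa using ENNReal.ofReal_le_ofReal hp.le
  have hpe0 : ENNReal.ofReal p ≠ 0 := (one_pos.trans_le hp1).ne'
  set k : ℝ → ℝ := fun θ => ((circleMap 0 s θ + r) / (circleMap 0 s θ - r)).re with hk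
  have hkper : Function.Periodic k (2 * Real.pi) := fun θ => by
    simp only [hk, periodic_circleMap 0 s θ]
  have hrb : (r : ℂ) ∈ Metric.ball (0 : ℂ) s := by simpa [abs_of_pos hr] using hrs
  have hk0 : ∀ θ, 0 ≤ k θ := by
    intro θ
    have hsp : circleMap 0 s θ ∈ Metric.sphere (0 : ℂ) s := by simp [abs_of_pos hs0]
    have l := le_re_herglotzRieszKernel hsp hrb
    simp only [sub_zero] at l
    refine le_trans (div_nonneg ?_ ?_) l <;> simp [abs_of_pos hr] <;> linarith
  have hkm : Measurable k := by
    simp only [hk]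
    fun_prop
  -- Poisson's formula at the point `r`
  have poisson : ∀ {F : ℂ → ℂ}, DiffContOnCl ℂ F (Metric.ball 0 s) →
      F r = (2 * Real.pi)⁻¹ • ∫ θ in Ioc (-Real.pi) Real.pi, k θ • F (circleMap 0 s θ) := by
    intro F hF
    have key := hF.circleAverage_re_herglotzRieszKernel_smul' hrb
    simp only [sub_zero, Real.circleAverage_def] at key
    have hper : Function.Periodic (fun θ => k θ • F (circleMap 0 s θ)) (2 * Real.pi) :=
      fun θ => by simp only [hkper θ, periodic_circleMap 0 s θ]
    have h2 := hper.intervalIntegral_add_eq (-Real.pi) 0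
    rw [zero_add, show -Real.pi + 2 * Real.pi = Real.pi by ring] at h2
    rw [← key, ← intervalIntegral.integral_of_le (by linarith [Real.pi_pos]), h2]
  set d : ℝ → ℝ≥0∞ := fun θ => ENNReal.ofReal (1 / (2 * Real.pi) * k θ) with hd
  have hdm : Measurable d := by fun_prop
  set ν : Measure ℝ := (volume.restrict (Ioc (-Real.pi) Real.pi)).withDensity d with hν
  have hkint : IntegrableOn k (Ioc (-Real.pi) Real.pi) := by
    by_contra hcon
    have h1 := poisson (F := fun _ => 1) diffContOnCl_const
    simp only [Complex.real_smul, mul_one] at h1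
    rw [integral_complex_ofReal, integral_undef hcon] at h1
    simp at h1
  have hprob : IsProbabilityMeasure ν := by
    constructor
    have h1 := poisson (F := fun _ => 1) diffContOnCl_const
    simp only [Complex.real_smul, mul_one] at h1
    rw [integral_complex_ofReal] at h1
    rw [hν, withDensity_apply _ MeasurableSet.univ, Measure.restrict_univ, hd,
      ← ofReal_integral_eq_lintegral_ofReal (hkint.const_mul _)
        (ae_of_all _ fun θ => mul_nonneg (by positivity) (hk0 θ)), integral_const_mul,
      ENNReal.ofReal_eq_one, one_div]
    exact_mod_cast h1.symm
  have hfm := measurable_of_holomorphic hf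
  have hrot : ∀ θ φ : ℝ, circleMap 0 s θ * Complex.exp (φ * Complex.I) =
      circleMap 0 s (θ + φ) := by
    intro θ φ
    simp only [circleMap, zero_add, Complex.ofReal_add, add_mul, Complex.exp_add]
    ring
  have hpt : ∀ φ : ℝ, ‖f (circleMap 0 r φ)‖ₑ ^ p ≤
      ∫⁻ θ, ‖f (circleMap 0 s (θ + φ))‖ₑ ^ p ∂ν := by
    intro φ
    have hF : DiffContOnCl ℂ (fun z => f (z * Complex.exp (φ * Complex.I)))
        (Metric.ball 0 s) := by
      have h1 : DifferentiableOn ℂ (fun z => f (z * Complex.exp (φ * Complex.I))) disc := by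
        refine hf.1.comp (by fun_prop) fun z hz => ?_
        simpa [Complex.norm_exp_ofReal_mul_I] using hz
      refine (h1.mono ?_).diffContOnCl
      rw [closure_ball _ hs0.ne']
      exact Metric.closedBall_subset_ball hs
    have h1 := poisson hF
    simp only [hrot] at h1
    have h2 : (r : ℂ) * Complex.exp (φ * Complex.I) = circleMap 0 r φ := by simp [circleMap]
    rw [h2] at h1
    have hgm : Measurable fun θ => f (circleMap 0 s (θ + φ)) := hfm.comp (by fun_prop)
    have h3 : ‖f (circleMap 0 r φ)‖ₑ ≤ eLpNorm (fun θ => f (circleMap 0 s (θ + φ))) 1 ν := by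
      rw [eLpNorm_one_eq_lintegral_enorm, hν,
        lintegral_withDensity_eq_lintegral_mul _ hdm hgm.enorm, h1, enorm_smul]
      refine (mul_le_mul' le_rfl (enorm_integral_le_lintegral_enorm _)).trans ?_
      rw [← lintegral_const_mul' _ _ enorm_ne_top]
      refine lintegral_mono fun θ => ?_
      rw [enorm_smul, ← mul_assoc, Pi.mul_apply, hd]
      refine mul_le_mul' ?_ le_rfl
      rw [Real.enorm_eq_ofReal (by positivity), Real.enorm_eq_ofReal (hk0 θ),
        ← ENNReal.ofReal_mul (by positivity), one_div]
    have h4 := h3.trans (eLpNorm_le_eLpNorm_of_exponent_le hp1 hgm.aestronglyMeasurable)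
    rw [eLpNorm_eq_lintegral_rpow_enorm_toReal hpe0 ENNReal.ofReal_ne_top,
      ENNReal.toReal_ofReal hp0.le] at h4
    have h5 := ENNReal.rpow_le_rpow h4 hp0.le
    rwa [← ENNReal.rpow_mul, one_div_mul_cancel hp0.ne', ENNReal.rpow_one] at h5
  rw [eLpNorm_eq_lintegral_rpow_enorm_toReal hpe0 ENNReal.ofReal_ne_top,
    eLpNorm_eq_lintegral_rpow_enorm_toReal hpe0 ENNReal.ofReal_ne_top,
    ENNReal.toReal_ofReal hp0.le]
  refine ENNReal.rpow_le_rpow ?_ (by positivity)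
  rw [lintegral_circleMeasure r (hfm.enorm.pow_const p),
    lintegral_circleMeasure s (hfm.enorm.pow_const p)]
  refine mul_le_mul' le_rfl ?_
  have hjm : Measurable fun q : ℝ × ℝ => ‖f (circleMap 0 s (q.2 + q.1))‖ₑ ^ p := by
    refine (Measurable.enorm (hfm.comp ?_)).pow_const p
    fun_prop
  calc ∫⁻ φ in Ioc (-Real.pi) Real.pi, ‖f (circleMap 0 r φ)‖ₑ ^ p
      ≤ ∫⁻ φ in Ioc (-Real.pi) Real.pi, ∫⁻ θ, ‖f (circleMap 0 s (θ + φ))‖ₑ ^ p ∂ν :=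
        lintegral_mono hpt
    _ = ∫⁻ θ, (∫⁻ φ in Ioc (-Real.pi) Real.pi, ‖f (circleMap 0 s (θ + φ))‖ₑ ^ p) ∂ν :=
        lintegral_lintegral_swap hjm.aemeasurable
    _ = ∫⁻ _, (∫⁻ φ in Ioc (-Real.pi) Real.pi, ‖f (circleMap 0 s φ)‖ₑ ^ p) ∂ν := by
        refine lintegral_congr fun θ => ?_
        refine lintegral_periodic (g := fun φ => ‖f (circleMap 0 s φ)‖ₑ ^ p) (fun φ => ?_) θ
        simp only [periodic_circleMap 0 s φ]
    _ = ∫⁻ φ in Ioc (-Real.pi) Real.pi, ‖f (circleMap 0 s φ)‖ₑ ^ p := by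
        rw [lintegral_const, measure_univ, mul_one]

/-- The supremum defining the Hardy norm is the limit of the integral means as `r → 1`. -/
theorem tendsto_hardyENorm {f : ℂ → ℂ} (hf : f ∈ holomorphic) {p : ℝ} (hp : 1 < p) :
    Tendsto (fun r => eLpNorm f (ENNReal.ofReal p) (circleMeasure r)) (𝓝[<] 1)
      (𝓝 (hardyENorm p f)) := by
  refine tendsto_order.2 ⟨fun a ha => ?_, fun a ha => ?_⟩
  · rw [hardyENorm] at ha
    obtain ⟨r, hr⟩ := lt_iSup_iff.1 ha
    obtain ⟨hr1, hr⟩ := lt_iSup_iff.1 hr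
    filter_upwards [Ioo_mem_nhdsLT hr1.2] with s hs
    exact hr.trans_le (eLpNorm_circleMeasure_mono hf hp hr1.1 hs.1 hs.2)
  · filter_upwards [Ioo_mem_nhdsLT (zero_lt_one' ℝ)] with s hs
    exact (le_iSup₂ (f := fun r (_ : r ∈ Ioo (0 : ℝ) 1) =>
      eLpNorm f (ENNReal.ofReal p) (circleMeasure r)) s hs).trans_lt ha

/-- Point evaluations are bounded, locally uniformly in the disc. -/
theorem SpaceKind.exists_enorm_apply_le (s : SpaceKind) {ρ : ℝ} (hρ : ρ < 1) :
    ∃ C : ℝ≥0∞, C ≠ ∞ ∧ ∀ f ∈ holomorphic, ∀ z, ‖z‖ ≤ ρ → ‖f z‖ₑ ≤ C * s.enorm f := by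
  rcases lt_or_ge ρ 0 with h0 | h0
  · exact ⟨0, by simp, fun f _ z hz => absurd ((norm_nonneg z).trans hz) (not_le.2 h0)⟩
  have h1p := s.one_le_expo
  cases s with
  | hardy p hp =>
    refine ⟨ENNReal.ofReal (2 / ((1 - ρ) / 2)), ENNReal.ofReal_ne_top, fun f hf z hz => ?_⟩
    have := isProbabilityMeasure_circleMeasure ((1 + ρ) / 2)
    refine (enorm_apply_le_circle hf (r := (1 + ρ) / 2) (by linarith) (by linarith)).trans ?_
    refine mul_le_mul' ?_ ?_
    · refine ENNReal.ofReal_le_ofReal ?_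
      gcongr <;> linarith
    · rw [← eLpNorm_one_eq_lintegral_enorm]
      refine (eLpNorm_le_eLpNorm_of_exponent_le h1p
        (measurable_of_holomorphic hf).aestronglyMeasurable).trans ?_
      exact le_iSup₂ (f := fun r (_ : r ∈ Ioo (0 : ℝ) 1) =>
        eLpNorm f (ENNReal.ofReal p) (circleMeasure r)) ((1 + ρ) / 2)
        ⟨by linarith, by linarith⟩
  | bergman p α hp hα =>
    have h3 : (ρ + 2) / 3 < 1 := by linarith
    obtain ⟨C, hC, H⟩ := enorm_apply_le_disc h0 (R₁ := (2 * ρ + 1) / 3) (R₂ := (ρ + 2) / 3)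
      (by linarith) (by linarith) h3
    set R : ℝ := (ρ + 2) / 3 with hR
    set ν : Measure ℂ := volume.restrict (Metric.ball 0 R) with hν
    have hνf : ν univ ≠ ∞ := by
      rw [hν, Measure.restrict_apply_univ]
      exact measure_ball_lt_top.ne
    -- lower bound of the weight on the smaller disc
    set a : ℝ := (α + 1) / Real.pi * min 1 ((1 - R ^ 2) ^ α) with ha
    have hR2 : 0 < 1 - R ^ 2 := by nlinarith
    have ha0 : 0 < a := by
      have : 0 < (1 - R ^ 2) ^ α := Real.rpow_pos_of_pos hR2 α
      have : 0 < α + 1 := by linarith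
      have := Real.pi_pos
      positivity
    have hle : ENNReal.ofReal a • ν ≤ bergmanMeasure α := by
      rw [bergmanMeasure, ← withDensity_const, hν, ← restrict_withDensity measurableSet_ball,
        ← restrict_withDensity measurableSet_ball]
      have hsub : Metric.ball (0 : ℂ) R ⊆ disc := Metric.ball_subset_ball h3.le
      rw [restrict_withDensity measurableSet_ball]
      refine (withDensity_mono (g := fun z : ℂ =>
        ENNReal.ofReal ((α + 1) / Real.pi * (1 - ‖z‖ ^ 2) ^ α)) ?_).trans ?_
      · refine (ae_restrict_iff' measurableSet_ball).2 (ae_of_all _ fun z hz => ?_)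
        refine ENNReal.ofReal_le_ofReal ?_
        have hz' : ‖z‖ < R := by simpa using hz
        have hz2 : ‖z‖ ^ 2 < R ^ 2 := by nlinarith [norm_nonneg z]
        have hα1 : 0 ≤ (α + 1) / Real.pi := div_nonneg (by linarith) Real.pi_pos.le
        refine mul_le_mul_of_nonneg_left ?_ hα1
        rcases le_total 0 α with hα0 | hα0
        · exact (min_le_right _ _).trans
            (Real.rpow_le_rpow hR2.le (by linarith) hα0)
        · refine (min_le_left _ _).trans ?_
          exact Real.one_le_rpow_of_pos_of_le_one_of_nonpos (by linarith)
            (by nlinarith [sq_nonneg ‖z‖]) hα0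
      · rw [← restrict_withDensity measurableSet_ball]
        exact Measure.restrict_mono hsub le_rfl
    set e : ℝ := 1 / (1 : ℝ≥0∞).toReal - 1 / (ENNReal.ofReal p).toReal with he
    have he0 : 0 ≤ e := by
      rw [he, ENNReal.toReal_ofReal (by linarith), ENNReal.toReal_one, sub_nonneg]
      exact one_div_le_one_div_of_le one_pos hp.le
    set b : ℝ≥0∞ := ENNReal.ofReal a ^ (1 / ENNReal.ofReal p).toReal with hb
    have hb0 : b ≠ 0 := by
      rw [hb]
      exact (ENNReal.rpow_pos (ENNReal.ofReal_pos.2 ha0) ENNReal.ofReal_ne_top).ne'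
    have hbt : b ≠ ∞ := ENNReal.rpow_ne_top_of_nonneg ENNReal.toReal_nonneg ENNReal.ofReal_ne_top
    refine ⟨C * (b⁻¹ * ν univ ^ e), ENNReal.mul_ne_top hC (ENNReal.mul_ne_top
      (ENNReal.inv_ne_top.2 hb0) (ENNReal.rpow_ne_top_of_nonneg he0 hνf)), fun f hf z hz => ?_⟩
    refine (H f hf z hz).trans ?_
    rw [mul_assoc]
    gcongr
    rw [← eLpNorm_one_eq_lintegral_enorm]
    refine (eLpNorm_le_eLpNorm_mul_rpow_measure_univ h1p
      (measurable_of_holomorphic hf).aestronglyMeasurable).trans ?_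
    have h5 : b * eLpNorm f (ENNReal.ofReal p) ν ≤ bergmanENorm p α f := by
      rw [bergmanENorm, hb, ← smul_eq_mul, ← eLpNorm_smul_measure_of_ne_top ENNReal.ofReal_ne_top]
      exact eLpNorm_mono_measure f hle
    rw [mul_right_comm]
    refine mul_le_mul_left ?_ _
    rwa [← ENNReal.mul_le_iff_le_inv hb0 hbt]

namespace SpaceKind

/-- `H^p` or `A^p_α`: the analytic functions on the disc with finite norm. -/
def submodule (s : SpaceKind) : Submodule ℂ (ℂ → ℂ) where
  carrier := {f | f ∈ holomorphic ∧ s.enorm f < ∞}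
  add_mem' := fun {f g} hf hg => ⟨holomorphic.add_mem hf.1 hg.1,
    (s.enorm_add_le hf.1 hg.1).trans_lt (ENNReal.add_lt_top.2 ⟨hf.2, hg.2⟩)⟩
  zero_mem' := ⟨holomorphic.zero_mem, by simp [enorm_zero]⟩
  smul_mem' := fun c f hf => ⟨holomorphic.smul_mem c hf.1, by
    rw [enorm_smul]; exact ENNReal.mul_lt_top enorm_lt_top hf.2⟩

/-- `H^p` or `A^p_α` as a type. It carries the `H^p` or `A^p_α` norm and the topology of that norm (not
the topology of pointwise convergence). -/
def Space (s : SpaceKind) : Type := s.submodule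

/-- An element of the space from a function. -/
def Space.mk {s : SpaceKind} (f : ℂ → ℂ) (h : f ∈ s.submodule) : s.Space := ⟨f, h⟩

variable {s : SpaceKind}

instance : AddCommGroup s.Space := inferInstanceAs (AddCommGroup s.submodule)

instance : Module ℂ s.Space := inferInstanceAs (Module ℂ s.submodule)

instance : CoeFun s.Space (fun _ => ℂ → ℂ) := ⟨fun f => f.1⟩

instance : Norm s.Space := ⟨fun f => (s.enorm f).toReal⟩

theorem norm_def (f : s.Space) : ‖f‖ = (s.enorm f).toReal := rfl

theorem ofReal_norm_eq (f : s.Space) : ENNReal.ofReal ‖f‖ = s.enorm f :=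
  ENNReal.ofReal_toReal f.2.2.ne

theorem core (s : SpaceKind) : NormedSpace.Core ℂ s.Space where
  norm_nonneg _ := ENNReal.toReal_nonneg
  norm_smul c f := by
    rw [norm_def, norm_def]
    change (s.enorm (c • (f : ℂ → ℂ))).toReal = _
    rw [enorm_smul, ENNReal.toReal_mul, toReal_enorm]
  norm_triangle f g := by
    simp only [norm_def]
    rw [← ENNReal.toReal_add f.2.2.ne g.2.2.ne]
    exact ENNReal.toReal_mono (ENNReal.add_ne_top.2 ⟨f.2.2.ne, g.2.2.ne⟩)
      (s.enorm_add_le f.2.1 g.2.1)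
  norm_eq_zero_iff f := by
    rw [norm_def, ENNReal.toReal_eq_zero_iff, or_iff_left f.2.2.ne]
    constructor
    · intro h
      refine Subtype.ext (funext fun z => ?_)
      by_cases hz : z ∈ disc
      · obtain ⟨C, -, hC⟩ := s.exists_enorm_apply_le (ρ := ‖z‖) (by simpa using hz)
        have := hC f f.2.1 z le_rfl
        rw [h, mul_zero, nonpos_iff_eq_zero, enorm_eq_zero] at this
        exact this
      · exact f.2.1.2 z hz
    · rintro rfl
      exact s.enorm_zero

instance : NormedAddCommGroup s.Space := NormedAddCommGroup.ofCore (core s)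

instance : NormedSpace ℂ s.Space := NormedSpace.ofCore (core s)

theorem enorm_eq_enorm (f : s.Space) : ‖f‖ₑ = s.enorm f := by
  rw [← ofReal_norm, ofReal_norm_eq]

instance : CompleteSpace s.Space := by
  refine Metric.complete_of_cauchySeq_tendsto fun u hu => ?_
  have hN : ∀ i j, s.enorm ((u i : ℂ → ℂ) - u j) = ENNReal.ofReal (dist (u i) (u j)) := by
    intro i j
    rw [dist_eq_norm, ofReal_norm_eq]
    rfl
  have hev : ∀ {ρ : ℝ}, ρ < 1 → ∃ C : ℝ, 0 < C ∧ ∀ i j z, ‖z‖ ≤ ρ →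
      dist (u i z) (u j z) ≤ C * dist (u i) (u j) := by
    intro ρ hρ
    obtain ⟨C, hC, H⟩ := s.exists_enorm_apply_le hρ
    refine ⟨C.toReal + 1, by positivity, fun i j z hz => ?_⟩
    have := H _ (holomorphic.sub_mem (u i).2.1 (u j).2.1) z hz
    rw [hN, Pi.sub_apply, ← ofReal_norm, ← ENNReal.ofReal_toReal hC,
      ← ENNReal.ofReal_mul ENNReal.toReal_nonneg, ENNReal.ofReal_le_ofReal_iff (by positivity),
      ← dist_eq_norm] at this
    exact this.trans (by gcongr; linarith)
  have hcau : ∀ {ρ : ℝ}, ρ < 1 → UniformCauchySeqOn (fun n z => u n z) atTop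
      (Metric.closedBall (0 : ℂ) ρ) := by
    intro ρ hρ
    obtain ⟨C, hC, H⟩ := hev hρ
    rw [Metric.uniformCauchySeqOn_iff]
    intro ε hε
    obtain ⟨N, hN⟩ := Metric.cauchySeq_iff.1 hu (ε / C) (by positivity)
    refine ⟨N, fun m hm n hn z hz => (H m n z (by simpa using hz)).trans_lt ?_⟩
    have := hN m hm n hn
    rwa [lt_div_iff₀ hC, mul_comm] at this
  have hlim : ∀ z, ∃ w, Tendsto (fun n => u n z) atTop (𝓝 w) := by
    intro z
    by_cases hz : z ∈ disc
    · exact cauchySeq_tendsto_of_complete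
        ((hcau (ρ := ‖z‖) (by simpa using hz)).cauchySeq (by simp))
    · exact ⟨0, tendsto_const_nhds.congr fun n => ((u n).2.1.2 z hz).symm⟩
  choose f hf using hlim
  have hfh : f ∈ holomorphic := by
    refine ⟨?_, fun z hz => tendsto_nhds_unique (hf z)
      (tendsto_const_nhds.congr fun n => ((u n).2.1.2 z hz).symm)⟩
    refine TendstoLocallyUniformlyOn.differentiableOn (φ := atTop) (F := fun n z => u n z) ?_
      (Eventually.of_forall fun n => (u n).2.1.1) Metric.isOpen_ball
    rw [tendstoLocallyUniformlyOn_iff_forall_isCompact Metric.isOpen_ball]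
    intro K hK hKc
    obtain ⟨ρ, hρ, hKρ⟩ : ∃ ρ < 1, K ⊆ Metric.closedBall (0 : ℂ) ρ := by
      rcases K.eq_empty_or_nonempty with rfl | hne
      · exact ⟨0, one_pos, empty_subset _⟩
      · obtain ⟨x, hx, hmax⟩ := hKc.exists_isMaxOn hne continuous_norm.continuousOn
        exact ⟨‖x‖, by simpa using hK hx, fun y hy => by simpa using hmax hy⟩
    exact ((hcau hρ).tendstoUniformlyOn_of_tendsto fun z _ => hf z).mono hKρ
  have hdist : ∀ ε > 0, ∃ N, ∀ n ≥ N, s.enorm ((u n : ℂ → ℂ) - f) ≤ ENNReal.ofReal ε := by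
    intro ε hε
    obtain ⟨N, hN'⟩ := Metric.cauchySeq_iff.1 hu ε hε
    refine ⟨N, fun n hn => ?_⟩
    refine (s.enorm_le_liminf (f := fun j => (u n : ℂ → ℂ) - u j)
      (fun j => holomorphic.sub_mem (u n).2.1 (u j).2.1)
      (fun z => tendsto_const_nhds.sub (hf z))).trans ?_
    refine liminf_le_of_le (by isBoundedDefault) fun b hb => ?_
    obtain ⟨j, hj, hjN⟩ := (hb.and (eventually_ge_atTop N)).exists
    refine hj.trans ?_
    rw [hN]
    exact ENNReal.ofReal_le_ofReal (hN' n hn j hjN).le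
  have hfs : f ∈ s.submodule := by
    refine ⟨hfh, ?_⟩
    obtain ⟨N, hN'⟩ := hdist 1 one_pos
    have h1 : f = (u N : ℂ → ℂ) + (-1 : ℂ) • ((u N : ℂ → ℂ) - f) := by
      ext z; simp
    rw [h1]
    refine (s.enorm_add_le (u N).2.1 (holomorphic.smul_mem _
      (holomorphic.sub_mem (u N).2.1 hfh))).trans_lt ?_
    rw [enorm_smul]
    refine ENNReal.add_lt_top.2 ⟨(u N).2.2, ENNReal.mul_lt_top enorm_lt_top ?_⟩
    exact (hN' N le_rfl).trans_lt ENNReal.ofReal_lt_top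
  refine ⟨Space.mk f hfs, Metric.tendsto_atTop.2 fun ε hε => ?_⟩
  obtain ⟨N, hN'⟩ := hdist (ε / 2) (by positivity)
  refine ⟨N, fun n hn => ?_⟩
  have := hN' n hn
  rw [dist_eq_norm, norm_def]
  change (s.enorm ((u n : ℂ → ℂ) - f)).toReal < ε
  exact (ENNReal.toReal_le_of_le_ofReal (by positivity) this).trans_lt (by linarith)

end SpaceKind

/-- `H^∞`: the bounded analytic functions on the unit disc. -/
def HInfty : Submodule ℂ (ℂ → ℂ) where
  carrier := {g | g ∈ holomorphic ∧ ∃ C : ℝ, ∀ z ∈ disc, ‖g z‖ ≤ C}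
  add_mem' := fun {f g} ⟨hf, C, hC⟩ ⟨hg, D, hD⟩ => ⟨holomorphic.add_mem hf hg, C + D,
    fun z hz => (norm_add_le _ _).trans (add_le_add (hC z hz) (hD z hz))⟩
  zero_mem' := ⟨holomorphic.zero_mem, 0, by simp⟩
  smul_mem' := fun c f ⟨hf, C, hC⟩ => ⟨holomorphic.smul_mem c hf, ‖c‖ * C, fun z hz => by
    rw [Pi.smul_apply, norm_smul]; exact mul_le_mul_of_nonneg_left (hC z hz) (norm_nonneg c)⟩

theorem HInfty.exists_bound (g : HInfty) : ∃ C : ℝ, ∀ z (w : ℂ), ‖g.1 z * w‖ ≤ C * ‖w‖ := by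
  obtain ⟨hg, C, hC⟩ := g.2
  refine ⟨C, fun z w => ?_⟩
  rw [norm_mul]
  refine mul_le_mul_of_nonneg_right ?_ (norm_nonneg w)
  by_cases hz : z ∈ disc
  · exact hC z hz
  · rw [hg.2 z hz, norm_zero]
    exact (norm_nonneg _).trans (hC 0 (by simp))

namespace SpaceKind

/-- Multiplication by `g` as a linear map. -/
def mulLinear (s : SpaceKind) (g : HInfty) : s.Space →ₗ[ℂ] s.Space where
  toFun f := Space.mk (fun z => g.1 z * f z)
    ⟨⟨g.2.1.1.mul f.2.1.1, fun z hz => by simp [g.2.1.2 z hz]⟩, by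
      obtain ⟨C, hC⟩ := HInfty.exists_bound g
      exact (s.enorm_le_mul C fun z => hC z (f z)).trans_lt
        (ENNReal.mul_lt_top ENNReal.ofReal_lt_top f.2.2)⟩
  map_add' f h := Subtype.ext (funext fun z => mul_add (g.1 z) (f z) (h z))
  map_smul' c f := Subtype.ext (funext fun z => mul_left_comm (g.1 z) c (f z))

/-- The multiplication operator `M_g : f ↦ g f`, bounded on `H^p` and on `A^p_α` for `g ∈ H^∞`. -/
def mulOp (s : SpaceKind) (g : HInfty) : s.Space →L[ℂ] s.Space :=
  LinearMap.mkContinuousOfExistsBound (s.mulLinear g) <| by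
    obtain ⟨C, hC⟩ := HInfty.exists_bound g
    refine ⟨C ⊔ 0, fun f => ?_⟩
    have h : ∀ z, ‖(s.mulLinear g f) z‖ ≤ (C ⊔ 0) * ‖f z‖ := fun z =>
      (hC z (f z)).trans (mul_le_mul_of_nonneg_right le_sup_left (norm_nonneg _))
    rw [norm_def, norm_def, ← ENNReal.toReal_ofReal (le_sup_right : 0 ≤ C ⊔ 0),
      ← ENNReal.toReal_mul]
    exact ENNReal.toReal_mono (ENNReal.mul_ne_top ENNReal.ofReal_ne_top f.2.2.ne)
      (s.enorm_le_mul _ h)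

theorem mulOp_apply (s : SpaceKind) (g : HInfty) (f : s.Space) (z : ℂ) :
    s.mulOp g f z = g.1 z * f z := rfl

end SpaceKind

section Operators

variable {E : Type*} [NormedAddCommGroup E] [NormedSpace ℂ E]

/-- Weakly null sequences of unit vectors. -/
def IsWeaklyNullUnit (f : ℕ → E) : Prop :=
  (∀ n, ‖f n‖ = 1) ∧ ∀ ℓ : E →L[ℂ] ℂ, Tendsto (fun n => ℓ (f n)) atTop (𝓝 0)

/-- `EN(S) = sup limsup ‖S f_n‖`, the supremum over all weakly null sequences `(f_n)` of unit
vectors. -/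
def EN (S : E →L[ℂ] E) : ℝ≥0∞ :=
  ⨆ (f : ℕ → E) (_ : IsWeaklyNullUnit f), limsup (fun n => ‖S (f n)‖ₑ) atTop

/-- The condition `W(X)` on a family `(S_t)`, `t ∈ (0,1)`: for every `f`, the map `t ↦ S_t f` is
continuous on `(0,1)` and `∫₀¹ ‖S_t f‖ dt < ∞`. Values of `S` outside `(0,1)` play no role. -/
def ConditionW (S : ℝ → E →L[ℂ] E) : Prop :=
  ∀ f : E, ContinuousOn (fun t => S t f) (Ioo 0 1) ∧ ∫⁻ t in Ioo (0 : ℝ) 1, ‖S t f‖ₑ < ∞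

theorem ConditionW.integrable {S : ℝ → E →L[ℂ] E} (h : ConditionW S) (f : E) :
    Integrable (fun t => S t f) (volume.restrict (Ioo (0 : ℝ) 1)) :=
  ⟨(h f).1.aestronglyMeasurable measurableSet_Ioo, (h f).2⟩

/-- The limiting Minkowski equality: both limits exist (as real numbers) and
`lim ‖∫₀¹ S_t φ_n dt‖ = lim ∫₀¹ ‖S_t φ_n‖ dt`. -/
def CondI1 (S : ℝ → E →L[ℂ] E) (φ : ℕ → E) : Prop :=
  ∃ L : ℝ, Tendsto (fun n => ‖∫ t in Ioo (0 : ℝ) 1, S t (φ n)‖) atTop (𝓝 L) ∧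
    Tendsto (fun n => ∫ t in Ioo (0 : ℝ) 1, ‖S t (φ n)‖) atTop (𝓝 L)

/-- For almost every `t ∈ (0,1)`, `liminf ‖S_t φ_n‖ = EN(S_t)`. -/
def CondI2 (S : ℝ → E →L[ℂ] E) (φ : ℕ → E) : Prop :=
  ∀ᵐ t ∂(volume.restrict (Ioo (0 : ℝ) 1)),
    liminf (fun n => ‖S t (φ n)‖ₑ) atTop = EN (S t)

variable [CompleteSpace E]

/-- The map sending `f` to the class of `t ↦ S_t f` in `L¹((0,1); E)`. -/
def ConditionW.toL1 {S : ℝ → E →L[ℂ] E} (h : ConditionW S) :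
    E →ₗ[ℂ] Lp E 1 (volume.restrict (Ioo (0 : ℝ) 1)) where
  toFun f := (h.integrable f).toL1 _
  map_add' f g := by
    rw [← Integrable.toL1_add]
    congr 1
    ext t
    exact (S t).map_add f g
  map_smul' c f := by
    rw [RingHom.id_apply, ← Integrable.toL1_smul]
    congr 1
    ext t
    exact (S t).map_smul c f

theorem ConditionW.continuous_toL1 {S : ℝ → E →L[ℂ] E} (h : ConditionW S) :
    Continuous h.toL1 := by
  refine h.toL1.continuous_of_seq_closed_graph fun u x y hu hy => ?_
  obtain ⟨ns, hns, hae⟩ := (tendstoInMeasure_of_tendsto_Lp hy).exists_seq_tendsto_ae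
  have hcoe : ∀ᵐ t ∂(volume.restrict (Ioo (0 : ℝ) 1)), ∀ n, h.toL1 (u n) t = S t (u n) :=
    ae_all_iff.2 fun n => (h.integrable (u n)).coeFn_toL1
  refine Lp.ext ?_
  filter_upwards [hae, hcoe, (h.integrable x).coeFn_toL1] with t h1 h2 h3
  refine (tendsto_nhds_unique h1 ?_).trans h3.symm
  have : Tendsto (fun i => S t (u (ns i))) atTop (𝓝 (S t x)) :=
    ((S t).continuous.tendsto x).comp (hu.comp hns.tendsto_atTop)
  exact this.congr fun i => (h2 (ns i)).symm

/-- The bounded operator `∫₀¹ S_t dt : f ↦ ∫₀¹ S_t f dt` (Bochner integral in `E`). -/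
def integralOp (S : ℝ → E →L[ℂ] E) (h : ConditionW S) : E →L[ℂ] E where
  toFun f := ∫ t in Ioo (0 : ℝ) 1, S t f
  map_add' f g := by
    simp only [map_add]
    exact integral_add (h.integrable f) (h.integrable g)
  map_smul' c f := by
    simp only [map_smul, RingHom.id_apply]
    exact integral_smul c _
  cont := by
    have h1 : (fun f => ∫ t in Ioo (0 : ℝ) 1, S t f) = fun f => ∫ t in Ioo (0 : ℝ) 1, h.toL1 f t := by
      ext f
      exact (integral_congr_ae (h.integrable f).coeFn_toL1).symm
    change Continuous fun f => ∫ t in Ioo (0 : ℝ) 1, S t f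
    rw [h1]
    exact continuous_integral.comp h.continuous_toL1

end Operators

/-- Approximate evaluation maps: sequences of unit vectors for which there is a point `ξ` of the unit
circle such that `sup {|φ_n z| : z ∈ 𝔻 ∖ B(ξ, ε)} → 0` for every `ε > 0`. -/
def IsApproxEvaluation {s : SpaceKind} (φ : ℕ → s.Space) : Prop :=
  (∀ n, ‖φ n‖ = 1) ∧ ∃ ξ : ℂ, ‖ξ‖ = 1 ∧ ∀ ε > 0,
    Tendsto (fun n => ⨆ z ∈ disc \ Metric.ball ξ ε, ‖φ n z‖ₑ) atTop (𝓝 0)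

end DiscSpaces

end

open DiscSpaces

/-! The heart of the matter is that EN(M_g) equals the supremum of |g| (`EN_mulOp`), and that the
integral of the M_{g_t} is again a multiplication operator M_G with G in H^∞
(`integralOp_mulOp_apply`, `exists_eq_mulOp`).

The upper bound for EN(M_g) is immediate. For the lower bound, choose a boundary point ξ near which
|g| comes close to its supremum S, multiply g by a power of the peak function (1 + ξ̄z)/2 to get H,
and normalize the powers H^m. They concentrate at ξ, and the ratio of the norms of H^(m+1) and H^m
is close to S for suitable m, because point evaluations are bounded (`exists_concentrated`).
Concentrating sequences are weakly null: sums of N sparse terms with unimodular coefficients have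
norm O(N^(1/p)), whereas a functional that does not tend to zero along the sequence would be of size
N on such sums (`ConcentratesAt.isWeaklyNullUnit`).

If the equality holds, take a concentrating sequence (φ_n) that norms M_G. For unit vectors, ‖M_G
φ_n‖ ≤ ∫ ‖M_{g_t} φ_n‖ dt ≤ ∫ EN(M_{g_t}) dt, and the left end tends to the right end. This gives
(I1); since the second integrand is dominated pointwise by the third, a subsequence converges almost
everywhere, which gives (I2). Conversely, (I1) and (I2) give the equality by Fatou's lemma. -/

namespace DiscSpaces

/-! ### Total mass of the measures and their mass near a boundary point -/

/-- The weighted area measure is finite for `α > -1`. -/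
theorem isFiniteMeasure_bergmanMeasure {α : ℝ} (hα : -1 < α) :
    IsFiniteMeasure (bergmanMeasure α) := by
  constructor
  have hα1 : 0 ≤ (α + 1) / Real.pi := div_nonneg (by linarith) Real.pi_pos.le
  rw [bergmanMeasure, withDensity_apply _ MeasurableSet.univ, Measure.restrict_univ,
    ← lintegral_indicator measurableSet_ball, ← Complex.lintegral_comp_polarCoord_symm]
  -- The majorant 1 + (1 - r)^α of (1 - r²)^α serves both signs of α: the first term suffices for α
  -- ≥ 0, the second for α ≤ 0, where 1 - r ≤ 1 - r² is used. It is integrable since α > -1.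
  have hint : Integrable (fun r : ℝ => (α + 1) / Real.pi * (1 + (1 - r) ^ α))
      (volume.restrict (Ioo 0 1)) := by
    refine Integrable.const_mul ((integrable_const 1).add ?_) _
    have h := (intervalIntegral.intervalIntegrable_rpow' (a := 0) (b := 1) hα).comp_sub_left 1
    rw [sub_zero, sub_self, intervalIntegrable_iff, uIoc_of_ge zero_le_one] at h
    exact h.mono_set Ioo_subset_Ioc_self
  have hprod : Integrable (fun q : ℝ × ℝ => (α + 1) / Real.pi * (1 + (1 - q.1) ^ α))
      (volume.restrict (Ioo 0 1 ×ˢ Ioo (-Real.pi) Real.pi)) := by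
    rw [Measure.volume_eq_prod, ← Measure.prod_restrict]
    exact hint.comp_fst _
  refine lt_of_le_of_lt ?_ hprod.lintegral_lt_top
  rw [polarCoord_target, ← lintegral_indicator (measurableSet_Ioi.prod measurableSet_Ioo),
    ← lintegral_indicator (measurableSet_Ioo.prod measurableSet_Ioo)]
  refine lintegral_mono fun q => ?_
  by_cases hq : q ∈ Ioi (0 : ℝ) ×ˢ Ioo (-Real.pi) Real.pi
  swap
  · simp [indicator_of_notMem hq]
  rw [indicator_of_mem hq]
  have hn : ‖Complex.polarCoord.symm q‖ = q.1 := by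
    rw [Complex.norm_polarCoord_symm, abs_of_pos hq.1]
  have hmem : Complex.polarCoord.symm q ∈ disc ↔ q.1 < 1 := by rw [mem_ball_zero_iff, hn]
  by_cases hq1 : q.1 < 1
  swap
  · rw [indicator_of_notMem (mt hmem.1 hq1)]
    simp
  have hq0 : 0 < q.1 := hq.1
  have hq2 : q ∈ Ioo (0 : ℝ) 1 ×ˢ Ioo (-Real.pi) Real.pi := ⟨⟨hq0, hq1⟩, hq.2⟩
  rw [indicator_of_mem (hmem.2 hq1), indicator_of_mem hq2, hn]
  rw [smul_eq_mul, ← ENNReal.ofReal_mul hq0.le]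
  refine ENNReal.ofReal_le_ofReal ?_
  have hpow : (1 - q.1 ^ 2) ^ α ≤ 1 + (1 - q.1) ^ α := by
    have h1 : 0 ≤ (1 - q.1) ^ α := Real.rpow_nonneg (by linarith) _
    rcases le_total 0 α with h0 | h0
    · have := Real.rpow_le_one (x := 1 - q.1 ^ 2) (by nlinarith) (by nlinarith) h0
      linarith
    · have := Real.rpow_le_rpow_of_nonpos (x := 1 - q.1) (y := 1 - q.1 ^ 2) (by linarith)
        (by nlinarith) h0
      linarith
  have h2 : 0 ≤ (1 - q.1 ^ 2) ^ α := Real.rpow_nonneg (by nlinarith) _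
  calc q.1 * ((α + 1) / Real.pi * (1 - q.1 ^ 2) ^ α)
      ≤ 1 * ((α + 1) / Real.pi * (1 - q.1 ^ 2) ^ α) :=
        mul_le_mul_of_nonneg_right hq1.le (mul_nonneg hα1 h2)
    _ ≤ _ := by rw [one_mul]; exact mul_le_mul_of_nonneg_left hpow hα1

theorem circleMeasure_singleton {r : ℝ} (hr : r ≠ 0) (ξ : ℂ) : circleMeasure r {ξ} = 0 := by
  rw [circleMeasure, Measure.smul_apply, Measure.map_apply (by fun_prop) (measurableSet_singleton _),
    Measure.restrict_apply ((measurableSet_singleton _).preimage (by fun_prop))]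
  have : (circleMap 0 r ⁻¹' {ξ} ∩ Ioc (-Real.pi) Real.pi).Subsingleton := by
    intro a ha b hb
    have h := injOn_circleMap_of_abs_sub_le (a := -Real.pi) (b := Real.pi) (c := 0) hr
      (by rw [abs_of_nonpos] <;> linarith [Real.pi_pos])
    rw [uIoc_of_le (by linarith [Real.pi_pos])] at h
    exact h ha.2 hb.2 (ha.1.trans hb.1.symm)
  rw [this.measure_zero, smul_zero]

theorem exists_measure_ball_lt {μ : Measure ℂ} [IsFiniteMeasure μ] {ξ : ℂ} (h : μ {ξ} = 0)
    {δ : ℝ≥0∞} (hδ : δ ≠ 0) : ∃ ε > 0, μ (Metric.ball ξ ε) < δ := by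
  obtain ⟨U, hU, hUo, hμ⟩ := Set.exists_isOpen_lt_of_lt {ξ} δ (h ▸ pos_iff_ne_zero.2 hδ)
  obtain ⟨ε, hε, hb⟩ := Metric.isOpen_iff.1 hUo ξ (hU rfl)
  exact ⟨ε, hε, (measure_mono hb).trans_lt hμ⟩

/-- If re^{iθ} is within ε of ξ, then 1 - r < ε because |ξ| = 1. Pushing the point radially to the
unit circle therefore costs less than another ε, hence the radius 2ε. The bound no longer depends on
r. -/
theorem circleMeasure_ball_le {r ε : ℝ} (hr : r ∈ Ioo (0 : ℝ) 1) {ξ : ℂ} (hξ : ‖ξ‖ = 1) :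
    circleMeasure r (Metric.ball ξ ε) ≤ circleMeasure 1 (Metric.ball ξ (2 * ε)) := by
  rw [circleMeasure, circleMeasure, Measure.smul_apply, Measure.smul_apply,
    Measure.map_apply (by fun_prop) measurableSet_ball,
    Measure.map_apply (by fun_prop) measurableSet_ball]
  refine smul_le_smul_of_nonneg_left (measure_mono fun θ hθ => ?_) zero_le
  simp only [mem_preimage, Metric.mem_ball, dist_eq_norm] at hθ ⊢
  have h1 : ‖circleMap 0 1 θ - circleMap 0 r θ‖ = 1 - r := by
    have : circleMap 0 1 θ - circleMap 0 r θ = circleMap 0 (1 - r) θ := by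
      simp only [circleMap]
      push_cast
      ring
    rw [this, norm_circleMap_zero, abs_of_pos (by linarith [hr.2])]
  have h2 : 1 - r ≤ ‖circleMap 0 r θ - ξ‖ := by
    have := norm_sub_norm_le ξ (circleMap 0 r θ)
    rwa [hξ, norm_circleMap_zero, abs_of_pos hr.1, norm_sub_rev] at this
  have h3 := norm_sub_le_norm_sub_add_norm_sub (circleMap 0 1 θ) (circleMap 0 r θ) ξ
  linarith

namespace SpaceKind

theorem exists_measure_univ_le (s : SpaceKind) :
    ∃ K : ℝ≥0∞, K ≠ ∞ ∧ ∀ μ ∈ s.measures, μ univ ≤ K := by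
  cases s with
  | hardy p hp =>
    refine ⟨1, ENNReal.one_ne_top, ?_⟩
    rintro _ ⟨r, -, rfl⟩
    have := isProbabilityMeasure_circleMeasure r
    exact prob_le_one
  | bergman p α hp hα =>
    have := isFiniteMeasure_bergmanMeasure hα
    refine ⟨bergmanMeasure α univ, measure_ne_top _ _, ?_⟩
    rintro _ rfl
    exact le_rfl

/-- A single boundary point carries no mass. The radius has to be uniform over the measures because
the Hardy norm is a supremum over all circles. -/
theorem exists_measures_ball_le (s : SpaceKind) {ξ : ℂ} (hξ : ‖ξ‖ = 1) {δ : ℝ≥0∞} (hδ : δ ≠ 0) :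
    ∃ ε > 0, ∀ μ ∈ s.measures, μ (Metric.ball ξ ε) ≤ δ := by
  cases s with
  | hardy p hp =>
    have := isProbabilityMeasure_circleMeasure 1
    obtain ⟨ε, hε, h⟩ := exists_measure_ball_lt (circleMeasure_singleton one_ne_zero ξ) hδ
    refine ⟨ε / 2, by positivity, ?_⟩
    rintro _ ⟨r, hr, rfl⟩
    refine (circleMeasure_ball_le hr hξ).trans ?_
    rw [mul_div_cancel₀ _ two_ne_zero]
    exact h.le
  | bergman p α hp hα =>
    have := isFiniteMeasure_bergmanMeasure hα
    have h0 : bergmanMeasure α {ξ} = 0 := by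
      refine (withDensity_absolutelyContinuous _ _) ?_
      exact Measure.restrict_le_self.absolutelyContinuous (measure_singleton ξ)
    obtain ⟨ε, hε, h⟩ := exists_measure_ball_lt h0 hδ
    refine ⟨ε, hε, ?_⟩
    rintro _ rfl
    exact h.le

theorem eLpNorm_le_enorm (s : SpaceKind) {μ : Measure ℂ} (hμ : μ ∈ s.measures) (f : ℂ → ℂ) :
    eLpNorm f (ENNReal.ofReal s.expo) μ ≤ s.enorm f := by
  rw [enorm_eq]
  exact le_iSup₂ (f := fun μ _ => eLpNorm f (ENNReal.ofReal s.expo) μ) μ hμ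

theorem mem_submodule (s : SpaceKind) (g : HInfty) : g.1 ∈ s.submodule := by
  refine ⟨g.2.1, ?_⟩
  obtain ⟨C, hC⟩ := HInfty.exists_bound g
  obtain ⟨K, hK, hKμ⟩ := s.exists_measure_univ_le
  rw [enorm_eq]
  refine lt_of_le_of_lt (b := K ^ (ENNReal.ofReal s.expo).toReal⁻¹ * ENNReal.ofReal C) ?_
    (ENNReal.mul_lt_top (ENNReal.rpow_lt_top_of_nonneg (by positivity) hK) ENNReal.ofReal_lt_top)
  refine iSup₂_le fun μ hμ => (eLpNorm_le_of_ae_bound (C := C) (ae_of_all _ fun z => ?_)).trans ?_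
  · simpa using hC z 1
  · gcongr
    exact hKμ μ hμ

end SpaceKind

/-! ### The constant function, point evaluations and bounds for multiplication -/

/-- The constant function `1` on the disc. -/
noncomputable def HInfty.one : HInfty :=
  ⟨disc.indicator 1, ⟨(differentiableOn_const (1 : ℂ)).congr fun z hz => by simp [indicator_of_mem hz],
    fun z hz => indicator_of_notMem hz _⟩, 1, fun z hz => by simp [indicator_of_mem hz]⟩

theorem HInfty.one_apply {z : ℂ} (hz : z ∈ disc) : HInfty.one.1 z = 1 := indicator_of_mem hz _

namespace SpaceKind

/-- The constant function `1` as an element of the space. -/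
noncomputable def one (s : SpaceKind) : s.Space := Space.mk HInfty.one.1 (s.mem_submodule _)

theorem one_apply (s : SpaceKind) {z : ℂ} (hz : z ∈ disc) : s.one z = 1 := HInfty.one_apply hz

variable {s : SpaceKind}

theorem Space.apply_eq_zero (f : s.Space) {z : ℂ} (hz : z ∉ disc) : f z = 0 := f.2.1.2 z hz

theorem Space.ext {f h : s.Space} (H : ∀ z ∈ disc, f z = h z) : f = h := by
  refine Subtype.ext (funext fun z => ?_)
  by_cases hz : z ∈ disc
  · exact H z hz
  · exact (f.apply_eq_zero hz).trans (h.apply_eq_zero hz).symm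

variable (s) in
/-- Evaluation at a point, as a continuous functional. -/
noncomputable def eval (z : ℂ) : s.Space →L[ℂ] ℂ :=
  LinearMap.mkContinuousOfExistsBound
    { toFun := fun f => f z
      map_add' := fun _ _ => rfl
      map_smul' := fun _ _ => rfl } <| by
    by_cases hz : z ∈ disc
    · obtain ⟨C, hC, H⟩ := s.exists_enorm_apply_le (ρ := ‖z‖) (by simpa using hz)
      refine ⟨C.toReal, fun f => ?_⟩
      have := ENNReal.toReal_mono (ENNReal.mul_ne_top hC f.2.2.ne) (H f f.2.1 z le_rfl)
      rwa [ENNReal.toReal_mul, toReal_enorm] at this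
    · refine ⟨0, fun f => ?_⟩
      change ‖f z‖ ≤ _
      rw [f.apply_eq_zero hz]
      simp

theorem eval_apply (z : ℂ) (f : s.Space) : s.eval z f = f z := rfl

theorem add_apply (f h : s.Space) (z : ℂ) : (f + h) z = f z + h z := rfl

theorem smul_apply (c : ℂ) (f : s.Space) (z : ℂ) : (c • f) z = c * f z := rfl

theorem pow_mulOp_apply (g : HInfty) (m : ℕ) (f : s.Space) (z : ℂ) :
    (s.mulOp g ^ m) f z = g.1 z ^ m * f z := by
  induction m with
  | zero => simp
  | succ m ih => 
    rw [pow_succ']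
    change s.mulOp g ((s.mulOp g ^ m) f) z = _
    rw [mulOp_apply, ih, pow_succ', mul_assoc]

theorem enorm_mulOp_le {g : HInfty} {C : ℝ≥0∞} (h : ∀ z, ‖g.1 z‖ₑ ≤ C) (f : s.Space) :
    ‖s.mulOp g f‖ₑ ≤ C * ‖f‖ₑ := by
  rw [enorm_eq_enorm, enorm_eq_enorm]
  rcases eq_or_ne C ∞ with rfl | hC
  · by_cases hf : s.enorm f = 0
    · have : f = 0 := by rw [← enorm_eq_zero, enorm_eq_enorm, hf]
      subst this
      rw [map_zero]
      exact (s.enorm_zero).le.trans zero_le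
    · rw [ENNReal.top_mul hf]
      exact le_top
  rw [← ENNReal.ofReal_toReal hC]
  refine s.enorm_le_mul _ fun z => ?_
  rw [mulOp_apply, norm_mul]
  refine mul_le_mul_of_nonneg_right ?_ (norm_nonneg _)
  rw [← toReal_enorm]
  exact ENNReal.toReal_mono hC (h z)

theorem norm_mulOp_le {g : HInfty} {C : ℝ} (h : ∀ z, ‖g.1 z‖ ≤ C) (f : s.Space) :
    ‖s.mulOp g f‖ ≤ C * ‖f‖ := by
  have hC : 0 ≤ C := (norm_nonneg _).trans (h 0)
  have h1 := enorm_mulOp_le (s := s) (g := g) (C := ENNReal.ofReal C) (fun z => by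
    rw [← ofReal_norm]; exact ENNReal.ofReal_le_ofReal (h z)) f
  have := ENNReal.toReal_mono (ENNReal.mul_ne_top ENNReal.ofReal_ne_top enorm_ne_top) h1
  rwa [ENNReal.toReal_mul, toReal_enorm, toReal_enorm, ENNReal.toReal_ofReal hC] at this

/-! ### Concentrating sequences and their weak convergence to zero -/

/-- Sequences of unit vectors of bounded functions that concentrate at `ξ`. -/
structure ConcentratesAt (φ : ℕ → s.Space) (ξ : ℂ) : Prop where
  norm_point : ‖ξ‖ = 1
  norm_eq : ∀ n, ‖φ n‖ = 1
  bounded : ∀ n, ∃ C : ℝ, ∀ z, ‖φ n z‖ ≤ C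
  small : ∀ ε > 0, ∀ δ > 0, ∀ᶠ n in atTop, ∀ z ∈ disc \ Metric.ball ξ ε, ‖φ n z‖ ≤ δ

theorem ConcentratesAt.isApproxEvaluation {φ : ℕ → s.Space} {ξ : ℂ} (h : ConcentratesAt φ ξ) :
    IsApproxEvaluation φ := by
  refine ⟨h.norm_eq, ξ, h.norm_point, fun ε hε => ?_⟩
  refine ENNReal.tendsto_nhds_zero.2 fun δ hδ => ?_
  rcases eq_or_ne δ ∞ with rfl | hδt
  · exact Eventually.of_forall fun _ => le_top
  filter_upwards [h.small ε hε δ.toReal (ENNReal.toReal_pos hδ.ne' hδt)] with n hn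
  refine iSup₂_le fun z hz => ?_
  rw [← ofReal_norm]
  exact ENNReal.ofReal_le_of_le_toReal (hn z hz)

/-- The `p`-th powers of the norms of functions with disjoint supports add up. -/
theorem eLpNorm_add_rpow_le_of_disjoint {p : ℝ} (hp : 0 < p) {μ : Measure ℂ} {f h : ℂ → ℂ}
    {B : Set ℂ} (hB : MeasurableSet B) :
    eLpNorm (Bᶜ.indicator f + B.indicator h) (ENNReal.ofReal p) μ ^ p ≤
      eLpNorm f (ENNReal.ofReal p) μ ^ p + eLpNorm h (ENNReal.ofReal p) μ ^ p := by
  have key : ∀ F : ℂ → ℂ, eLpNorm F (ENNReal.ofReal p) μ ^ p = ∫⁻ z, ‖F z‖ₑ ^ p ∂μ := by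
    intro F
    rw [eLpNorm_eq_lintegral_rpow_enorm_toReal (by simpa using hp) ENNReal.ofReal_ne_top,
      ENNReal.toReal_ofReal hp.le, ← ENNReal.rpow_mul, one_div_mul_cancel hp.ne', ENNReal.rpow_one]
  rw [key, key, key, ← lintegral_add_compl _ hB, add_comm]
  refine add_le_add ?_ ?_
  · refine (setLIntegral_mono' hB.compl fun z hz => ?_).trans (setLIntegral_le_lintegral _ _)
    simp [indicator_of_mem hz, indicator_of_notMem (show z ∉ B from hz)]
  · refine (setLIntegral_mono' hB fun z hz => ?_).trans (setLIntegral_le_lintegral _ _)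
    simp [indicator_of_mem hz, indicator_of_notMem (show z ∉ Bᶜ from not_not.2 hz)]

/-- Adding a function concentrated near `ξ` to a bounded function is asymptotically an
`ℓ^p`-sum. -/
theorem ConcentratesAt.eventually_enorm_add_le {φ : ℕ → s.Space} {ξ : ℂ}
    (h : ConcentratesAt φ ξ) {S : s.Space} (hS : ∃ C : ℝ, ∀ z, ‖S z‖ ≤ C) {η : ℝ≥0∞} (hη : η ≠ 0) :
    ∀ᶠ n in atTop, ∀ c : ℂ, ‖c‖ = 1 →
      ‖S + c • φ n‖ₑ ≤ (‖S‖ₑ ^ s.expo + 1) ^ (1 / s.expo) + η := by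
  obtain ⟨C, hC⟩ := hS
  obtain ⟨K, hK, hKμ⟩ := s.exists_measure_univ_le
  have hp : 0 < s.expo := one_pos.trans s.one_lt_expo
  have hpi : 0 < (ENNReal.ofReal s.expo).toReal⁻¹ := by
    rw [ENNReal.toReal_ofReal hp.le]; positivity
  -- Two errors are to be kept below η/2: S on a ball of measure at most δ₁, where only |S| ≤ C is
  -- known, and φ_n off that ball, where it is at most δ₂ and the total mass is at most K.
  obtain ⟨δ₁, hδ₁, H₁⟩ : ∃ δ : ℝ≥0∞, δ ≠ 0 ∧
      δ ^ (ENNReal.ofReal s.expo).toReal⁻¹ * ENNReal.ofReal C ≤ η / 2 := by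
    have ht : Tendsto (fun δ : ℝ≥0∞ => δ ^ (ENNReal.ofReal s.expo).toReal⁻¹ * ENNReal.ofReal C)
        (𝓝[>] 0) (𝓝 (0 ^ (ENNReal.ofReal s.expo).toReal⁻¹ * ENNReal.ofReal C)) :=
      ENNReal.Tendsto.mul_const ((ENNReal.continuous_rpow_const.tendsto 0).mono_left
        nhdsWithin_le_nhds) (Or.inr ENNReal.ofReal_ne_top)
    rw [ENNReal.zero_rpow_of_pos hpi, zero_mul] at ht
    obtain ⟨δ, hδ, hδ0⟩ := ((ENNReal.tendsto_nhds_zero.1 ht (η / 2)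
      (ENNReal.half_pos hη)).and self_mem_nhdsWithin).exists
    exact ⟨δ, (show 0 < δ from hδ0).ne', hδ⟩
  obtain ⟨δ₂, hδ₂, H₂⟩ : ∃ δ : ℝ, 0 < δ ∧
      K ^ (ENNReal.ofReal s.expo).toReal⁻¹ * ENNReal.ofReal δ ≤ η / 2 := by
    have ht : Tendsto (fun δ : ℝ => K ^ (ENNReal.ofReal s.expo).toReal⁻¹ * ENNReal.ofReal δ)
        (𝓝[>] 0) (𝓝 (K ^ (ENNReal.ofReal s.expo).toReal⁻¹ * ENNReal.ofReal 0)) :=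
      ENNReal.Tendsto.const_mul ((ENNReal.continuous_ofReal.tendsto 0).mono_left
        nhdsWithin_le_nhds) (Or.inr (ENNReal.rpow_ne_top_of_nonneg hpi.le hK))
    rw [ENNReal.ofReal_zero, mul_zero] at ht
    obtain ⟨δ, hδ, hδ0⟩ := ((ENNReal.tendsto_nhds_zero.1 ht (η / 2)
      (ENNReal.half_pos hη)).and self_mem_nhdsWithin).exists
    exact ⟨δ, hδ0, hδ⟩
  obtain ⟨ε, hε, hB⟩ := s.exists_measures_ball_le h.norm_point hδ₁
  set B := Metric.ball ξ ε with hBdef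
  have hBm : MeasurableSet B := measurableSet_ball
  filter_upwards [h.small ε hε δ₂ hδ₂] with n hn c hc
  have hSm := measurable_of_holomorphic S.2.1
  have hfm := measurable_of_holomorphic (c • φ n).2.1
  have hfn : ‖c • φ n‖ₑ = 1 := by
    rw [← ofReal_norm, norm_smul, hc, h.norm_eq n, mul_one, ENNReal.ofReal_one]
  rw [enorm_eq_enorm, enorm_eq]
  refine iSup₂_le fun μ hμ => ?_
  set P := ENNReal.ofReal s.expo with hP
  -- The first bracket, S off B plus cφ_n on B, has disjoint supports and gives the ℓ^p-sum; the
  -- second collects the two errors.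
  have hdec : ((S + c • φ n : s.Space) : ℂ → ℂ) =
      (Bᶜ.indicator S + B.indicator (c • φ n : s.Space)) +
        (B.indicator S + Bᶜ.indicator (c • φ n : s.Space)) := by
    ext z
    rw [add_apply]
    by_cases hz : z ∈ B
    · simp [hz, add_comm]
    · simp [hz]
  have a1 : eLpNorm (Bᶜ.indicator S + B.indicator (c • φ n : s.Space)) P μ ≤
      (‖S‖ₑ ^ s.expo + 1) ^ (1 / s.expo) := by
    rw [one_div, ENNReal.le_rpow_inv_iff hp]
    refine (eLpNorm_add_rpow_le_of_disjoint hp hBm).trans ?_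
    gcongr
    · rw [enorm_eq_enorm]
      exact s.eLpNorm_le_enorm hμ _
    · refine ENNReal.rpow_le_one ?_ hp.le
      rw [← hfn, enorm_eq_enorm]
      exact s.eLpNorm_le_enorm hμ _
  have a2 : eLpNorm (B.indicator S) P μ ≤ η / 2 := by
    rw [eLpNorm_indicator_eq_eLpNorm_restrict hBm]
    refine (eLpNorm_le_of_ae_bound (C := C) (ae_of_all _ hC)).trans (le_trans ?_ H₁)
    gcongr
    rw [Measure.restrict_apply_univ]
    exact hB μ hμ
  have a3 : eLpNorm (Bᶜ.indicator (c • φ n : s.Space)) P μ ≤ η / 2 := by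
    refine (eLpNorm_le_of_ae_bound (C := δ₂) (ae_of_all _ fun z => ?_)).trans (le_trans ?_ H₂)
    · by_cases hz : z ∈ B
      · simpa [hz] using hδ₂.le
      · rw [indicator_of_mem (show z ∈ Bᶜ from hz), smul_apply, norm_mul, hc, one_mul]
        by_cases hzd : z ∈ disc
        · exact hn z ⟨hzd, hz⟩
        · rw [(φ n).apply_eq_zero hzd, norm_zero]
          exact hδ₂.le
    · gcongr
      exact hKμ μ hμ
  rw [hdec]
  have m1 : AEStronglyMeasurable (B.indicator (S : ℂ → ℂ)) μ :=
    (hSm.indicator hBm).aestronglyMeasurable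
  have m2 : AEStronglyMeasurable (Bᶜ.indicator ((c • φ n : s.Space) : ℂ → ℂ)) μ :=
    (hfm.indicator hBm.compl).aestronglyMeasurable
  have m3 : AEStronglyMeasurable
      (Bᶜ.indicator (S : ℂ → ℂ) + B.indicator ((c • φ n : s.Space) : ℂ → ℂ)) μ :=
    ((hSm.indicator hBm.compl).add (hfm.indicator hBm)).aestronglyMeasurable
  refine (eLpNorm_add_le m3 (m1.add m2) s.one_le_expo).trans (add_le_add a1 ?_)
  refine (eLpNorm_add_le m1 m2 s.one_le_expo).trans ?_
  exact (add_le_add a2 a3).trans (ENNReal.add_halves η).le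

/-- A gliding-hump argument that needs no description of the dual space. Finite sums of the φ_n stay
bounded functions, so `eventually_enorm_add_le` can be applied again with the sum so far as S. -/
theorem ConcentratesAt.isWeaklyNullUnit {φ : ℕ → s.Space} {ξ : ℂ} (h : ConcentratesAt φ ξ) :
    IsWeaklyNullUnit φ := by
  refine ⟨h.norm_eq, fun ℓ => ?_⟩
  by_contra hcon
  have hp1 := s.one_lt_expo
  have hp : 0 < s.expo := one_pos.trans hp1
  obtain ⟨δ, hδ, hfreq⟩ : ∃ δ > 0, ∃ᶠ n in atTop, δ ≤ ‖ℓ (φ n)‖ := by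
    rw [Metric.tendsto_nhds] at hcon
    push Not at hcon
    obtain ⟨δ, hδ, hf⟩ := hcon
    exact ⟨δ, hδ, hf.mono fun n hn => by simpa using hn⟩
  -- The bound 2N, in place of the ideal N, leaves room at each step for the error η: ‖S‖^p + 1 ≤ 2N
  -- + 1 < 2(N + 1).
  have hsum : ∀ N : ℕ, ∃ S : s.Space, (∃ C : ℝ, ∀ z, ‖S z‖ ≤ C) ∧
      ‖S‖ₑ ^ s.expo ≤ ENNReal.ofReal (2 * N) ∧ N * δ ≤ (ℓ S).re := by
    intro N
    induction N with
    | zero => exact ⟨0, ⟨0, fun z => (norm_zero (E := ℂ)).le⟩, by simp [hp], by simp⟩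
    | succ N ih =>
      obtain ⟨S, hb, hn, hl⟩ := ih
      obtain ⟨η, hη, H⟩ : ∃ η : ℝ≥0∞, η ≠ 0 ∧ ((‖S‖ₑ ^ s.expo + 1) ^ (1 / s.expo) + η) ^ s.expo ≤
          ENNReal.ofReal (2 * (N + 1 : ℕ)) := by
        have ht : Tendsto (fun η : ℝ≥0∞ => ((‖S‖ₑ ^ s.expo + 1) ^ (1 / s.expo) + η) ^ s.expo)
            (𝓝[>] 0) (𝓝 (((‖S‖ₑ ^ s.expo + 1) ^ (1 / s.expo) + 0) ^ s.expo)) :=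
          ((ENNReal.continuous_rpow_const.comp (continuous_const.add continuous_id)).tendsto
            0).mono_left nhdsWithin_le_nhds
        rw [add_zero, ← ENNReal.rpow_mul, one_div_mul_cancel hp.ne', ENNReal.rpow_one] at ht
        have hlt : ‖S‖ₑ ^ s.expo + 1 < ENNReal.ofReal (2 * (N + 1 : ℕ)) := by
          refine (add_le_add_left hn 1).trans_lt ?_
          rw [← ENNReal.ofReal_one, ← ENNReal.ofReal_add (by positivity) (by positivity),
            ENNReal.ofReal_lt_ofReal_iff (by positivity)]
          push_cast
          linarith
        obtain ⟨η, h1, h2⟩ := ((ht.eventually (gt_mem_nhds hlt)).and self_mem_nhdsWithin).exists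
        exact ⟨η, (show 0 < η from h2).ne', h1.le⟩
      obtain ⟨n, hn1, hn2⟩ := (hfreq.and_eventually (h.eventually_enorm_add_le hb hη)).exists
      have h0 : ℓ (φ n) ≠ 0 := fun h0 => by rw [h0, norm_zero] at hn1; linarith
      -- This unimodular factor turns ℓ(φ_n) into |ℓ(φ_n)|, so that the contributions add up without
      -- cancellation.
      set c : ℂ := (‖ℓ (φ n)‖ : ℂ) / ℓ (φ n) with hc
      have hc1 : ‖c‖ = 1 := by
        rw [hc, norm_div, Complex.norm_real, norm_norm, div_self (norm_ne_zero_iff.2 h0)]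
      obtain ⟨C, hC⟩ := hb
      obtain ⟨D, hD⟩ := h.bounded n
      refine ⟨S + c • φ n, ⟨C + D, fun z => ?_⟩, ?_, ?_⟩
      · rw [add_apply, smul_apply]
        refine (norm_add_le _ _).trans (add_le_add (hC z) ?_)
        rw [norm_mul, hc1, one_mul]
        exact hD z
      · exact (ENNReal.rpow_le_rpow (hn2 c hc1) hp.le).trans H
      · rw [map_add, map_smul, smul_eq_mul, hc, div_mul_cancel₀ _ h0, Complex.add_re,
          Complex.ofReal_re]
        push_cast
        linarith
  have hbound : ∀ N : ℕ, N * δ ≤ ‖ℓ‖ * (2 * N : ℝ) ^ (1 / s.expo) := by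
    intro N
    obtain ⟨S, -, hn, hl⟩ := hsum N
    refine hl.trans ((Complex.re_le_norm _).trans ((ℓ.le_opNorm S).trans ?_))
    gcongr
    rw [one_div, Real.le_rpow_inv_iff_of_pos (norm_nonneg _) (by positivity) hp]
    have := ENNReal.toReal_mono ENNReal.ofReal_ne_top hn
    rwa [← ENNReal.toReal_rpow, toReal_enorm, ENNReal.toReal_ofReal (by positivity)] at this
  -- Dividing `hbound` by N leaves a multiple of N^(1/p - 1), which tends to 0 because p > 1; this
  -- contradicts δ > 0.
  have hlim : Tendsto (fun N : ℕ => ‖ℓ‖ * (2 : ℝ) ^ (1 / s.expo) * (N : ℝ) ^ (-(1 - 1 / s.expo)))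
      atTop (𝓝 (‖ℓ‖ * (2 : ℝ) ^ (1 / s.expo) * 0)) := by
    refine ((tendsto_rpow_neg_atTop ?_).comp tendsto_natCast_atTop_atTop).const_mul _
    rw [sub_pos, div_lt_one hp]
    exact hp1
  rw [mul_zero] at hlim
  obtain ⟨N, hN, hN0⟩ := ((hlim.eventually (gt_mem_nhds hδ)).and (eventually_gt_atTop 0)).exists
  have hN0' : (0 : ℝ) < N := by exact_mod_cast hN0
  have := hbound N
  rw [Real.mul_rpow zero_le_two hN0'.le] at this
  rw [neg_sub, Real.rpow_sub hN0', Real.rpow_one, mul_div_assoc', div_lt_iff₀ hN0'] at hN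
  linarith

/-! ### Concentrating sequences that norm M_g, and the value of EN(M_g) -/

/-- Some ratio of the norms of consecutive powers of `H` is at least `|H(w)|`, asymptotically. -/
theorem frequently_lt_norm_pow_succ (s : SpaceKind) (H : HInfty) {w : ℂ} (hw : w ∈ disc) {a : ℝ}
    (ha : 0 < a) (haw : a < ‖H.1 w‖) :
    ∃ᶠ m in atTop, a * ‖(s.mulOp H ^ m) s.one‖ ≤ ‖(s.mulOp H ^ (m + 1)) s.one‖ := by
  intro hcon
  obtain ⟨M, hM⟩ := eventually_atTop.1 hcon
  set x : ℕ → ℝ := fun m => ‖(s.mulOp H ^ m) s.one‖ with hx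
  have hstep : ∀ k, x (M + k) ≤ a ^ k * x M := by
    intro k
    induction k with
    | zero => simp
    | succ k ih =>
      have h1 : x (M + k + 1) ≤ a * x (M + k) := (not_le.1 (hM (M + k) (by omega))).le
      calc x (M + (k + 1)) ≤ a * x (M + k) := h1
        _ ≤ a * (a ^ k * x M) := by gcongr
        _ = _ := by ring
  -- If the ratios were eventually below a, the norms would be O(a^m). Evaluation at w forces growth
  -- at least of order |H(w)|^m, which is faster.
  have hlow : ∀ m, ‖H.1 w‖ ^ m ≤ ‖s.eval w‖ * x m := by
    intro m
    have := (s.eval w).le_opNorm ((s.mulOp H ^ m) s.one)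
    rwa [eval_apply, pow_mulOp_apply, s.one_apply hw, mul_one, norm_pow] at this
  have hw0 : 0 < ‖H.1 w‖ := ha.trans haw
  have hb : ∀ k, (‖H.1 w‖ / a) ^ k ≤ ‖s.eval w‖ * x M / ‖H.1 w‖ ^ M := by
    intro k
    rw [div_pow, le_div_iff₀ (by positivity), div_mul_eq_mul_div, div_le_iff₀ (by positivity),
      ← pow_add, add_comm]
    refine (hlow _).trans ?_
    rw [mul_assoc, mul_comm (x M)]
    exact mul_le_mul_of_nonneg_left (hstep k) (norm_nonneg _)
  obtain ⟨k, hk⟩ := pow_unbounded_of_one_lt (‖s.eval w‖ * x M / ‖H.1 w‖ ^ M)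
    ((one_lt_div ha).2 haw)
  exact (hb k).not_gt hk

/-- This is the parallelogram law for 1 and ξ̄z, together with |1 - ξ̄z| = |z - ξ| and |z| < 1. -/
theorem norm_peak_le {ξ z : ℂ} (hξ : ‖ξ‖ = 1) (hz : z ∈ disc) :
    ‖(1 + star ξ * z) / 2‖ ^ 2 ≤ 1 - ‖z - ξ‖ ^ 2 / 4 := by
  have h1 : ‖z‖ < 1 := by simpa using hz
  have hsub : ‖1 - star ξ * z‖ = ‖z - ξ‖ := by
    have : star ξ * ξ = 1 := by
      rw [Complex.star_def, Complex.conj_mul', hξ]; norm_num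
    rw [← this, ← mul_sub, norm_mul, norm_star, hξ, one_mul, norm_sub_rev]
  have hpar := parallelogram_law_with_norm ℝ (1 : ℂ) (star ξ * z)
  rw [hsub, norm_one, norm_mul (star ξ), norm_star, hξ, one_mul] at hpar
  rw [norm_div, Complex.norm_ofNat]
  nlinarith [norm_nonneg z]

theorem norm_peak_le_one {ξ z : ℂ} (hξ : ‖ξ‖ = 1) (hz : z ∈ disc) :
    ‖(1 + star ξ * z) / 2‖ ≤ 1 := by
  have := norm_peak_le hξ hz
  nlinarith [sq_nonneg ‖z - ξ‖, norm_nonneg ((1 + star ξ * z) / 2)]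

/-- The functions `((1 + ξ̄ z) / 2)^j g` in `H^∞`. -/
theorem exists_peak_mul (g : HInfty) {ξ : ℂ} (hξ : ‖ξ‖ = 1) (j : ℕ) :
    ∃ H : HInfty, (∀ z, H.1 z = ((1 + star ξ * z) / 2) ^ j * g.1 z) ∧
      ∀ z, ‖H.1 z‖ ≤ ‖g.1 z‖ := by
  obtain ⟨⟨hg, hg0⟩, C, hC⟩ := g.2
  have hle : ∀ z, ‖((1 + star ξ * z) / 2) ^ j * g.1 z‖ ≤ ‖g.1 z‖ := by
    intro z
    by_cases hz : z ∈ disc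
    · rw [norm_mul, norm_pow]
      exact mul_le_of_le_one_left (norm_nonneg _)
        (pow_le_one₀ (norm_nonneg _) (norm_peak_le_one hξ hz))
    · simp [hg0 z hz]
  exact ⟨⟨fun z => ((1 + star ξ * z) / 2) ^ j * g.1 z, ⟨DifferentiableOn.mul (by fun_prop) hg,
    fun z hz => by simp [hg0 z hz]⟩, C, fun z hz => (hle z).trans (hC z hz)⟩, fun z => rfl, hle⟩

theorem norm_mono {f h : s.Space} (H : ∀ z, ‖f z‖ ≤ ‖h z‖) : ‖f‖ ≤ ‖h‖ := by
  rw [norm_def, norm_def]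
  refine ENNReal.toReal_mono h.2.2.ne ?_
  simpa using s.enorm_le_mul (f := f) (g := h) 1 (by simpa using H)

/-- Concentrated unit vectors on which `M_g` almost attains its norm. -/
theorem exists_concentrated (s : SpaceKind) {g : HInfty} {S : ℝ} (hS : 0 < S)
    (hg : ∀ z, ‖g.1 z‖ ≤ S) {ξ : ℂ} (hξ : ‖ξ‖ = 1) {w : ℕ → ℂ} (hw : ∀ n, w n ∈ disc)
    (hwξ : Tendsto w atTop (𝓝 ξ)) (hwS : Tendsto (fun n => ‖g.1 (w n)‖) atTop (𝓝 S))
    {ε : ℝ} (hε : 0 < ε) :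
    ∃ u : s.Space, ‖u‖ = 1 ∧ (∃ C : ℝ, ∀ z, ‖u z‖ ≤ C) ∧
      (∀ z ∈ disc \ Metric.ball ξ ε, ‖u z‖ ≤ ε) ∧ S - ε ≤ ‖s.mulOp g u‖ := by
  -- This j makes the peak factor at most 1/2 off the ball; the exponent becomes 2j since
  -- `norm_peak_le` bounds a square. The maximum with 0 covers ε > 2.
  obtain ⟨j, hj⟩ := exists_pow_lt_of_lt_one (x := (1 / 2 : ℝ)) (y := max (1 - ε ^ 2 / 4) 0)
    (by norm_num) (max_lt (by linarith [pow_pos hε 2]) one_pos)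
  obtain ⟨H, hH, hHg⟩ := exists_peak_mul g hξ (2 * j)
  have hoff : ∀ z ∈ disc \ Metric.ball ξ ε, ‖H.1 z‖ ≤ S / 2 := by
    intro z hz
    rw [hH, norm_mul, norm_pow, pow_mul]
    have h1 : ‖(1 + star ξ * z) / 2‖ ^ 2 ≤ max (1 - ε ^ 2 / 4) 0 := by
      refine (norm_peak_le hξ hz.1).trans (le_max_of_le_left ?_)
      have : ε ≤ ‖z - ξ‖ := by simpa [dist_eq_norm] using hz.2
      gcongr
    calc _ ≤ (1 / 2 : ℝ) * S := by
          refine mul_le_mul ?_ (hg z) (norm_nonneg _) (by norm_num)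
          exact (pow_le_pow_left₀ (by positivity) h1 j).trans hj.le
      _ = S / 2 := by ring
  have hHw : Tendsto (fun n => ‖H.1 (w n)‖) atTop (𝓝 S) := by
    have h1 : Tendsto (fun n => ‖((1 + star ξ * w n) / 2) ^ (2 * j)‖ * ‖g.1 (w n)‖) atTop
        (𝓝 (‖((1 + star ξ * ξ) / 2) ^ (2 * j)‖ * S)) := by
      refine Tendsto.mul ?_ hwS
      have hc : Continuous fun z : ℂ => ‖((1 + star ξ * z) / 2) ^ (2 * j)‖ := by fun_prop
      exact (hc.tendsto ξ).comp hwξ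
    have h2 : star ξ * ξ = 1 := by rw [Complex.star_def, Complex.conj_mul', hξ]; norm_num
    rw [h2] at h1
    norm_num at h1
    refine h1.congr fun n => ?_
    rw [hH, norm_mul, norm_pow, norm_div, Complex.norm_ofNat]
    simp
  -- The level a will lie above S/2, so that H^m decays off the ball relative to its norm, and above
  -- S - ε, so that M_g almost attains S.
  have hmax : max (S / 2) (S - ε) < S := max_lt (by linarith) (by linarith)
  obtain ⟨n, hn⟩ := (hHw.eventually (lt_mem_nhds hmax)).exists
  obtain ⟨a, ha1, ha2⟩ := exists_between hn
  have haS : S / 2 < a := (le_max_left _ _).trans_lt ha1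
  have ha0 : 0 < a := by linarith
  set N : ℝ := ‖s.eval (w n)‖ with hN
  set x : ℕ → ℝ := fun m => ‖(s.mulOp H ^ m) s.one‖ with hx
  have hlow : ∀ m, a ^ m ≤ N * x m := by
    intro m
    have := (s.eval (w n)).le_opNorm ((s.mulOp H ^ m) s.one)
    rw [eval_apply, pow_mulOp_apply, s.one_apply (hw n), mul_one, norm_pow] at this
    exact (pow_le_pow_left₀ ha0.le ha2.le m).trans this
  have hN0 : 0 < N := by
    have := hlow 0
    rw [pow_zero] at this
    by_contra hcon
    rw [le_antisymm (not_lt.1 hcon) (norm_nonneg _), zero_mul] at this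
    linarith
  -- Off the ball |H^m| ≤ (S/2)^m, while ‖H^m‖ ≥ a^m/N, so the quotient is at most N(S/(2a))^m,
  -- which tends to 0.
  have hsmall : ∀ᶠ m : ℕ in atTop, (S / 2) ^ m ≤ ε * x m := by
    have ht := (tendsto_pow_atTop_nhds_zero_of_lt_one (r := S / 2 / a) (by positivity)
      ((div_lt_one ha0).2 haS)).mul_const N
    rw [zero_mul] at ht
    filter_upwards [ht.eventually (gt_mem_nhds hε)] with m hm
    rw [div_pow, div_mul_eq_mul_div, div_lt_iff₀ (by positivity)] at hm
    have h2 := mul_le_mul_of_nonneg_left (hlow m) hε.le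
    refine le_of_mul_le_mul_right ?_ hN0
    linarith
  obtain ⟨m, hm1, hm2⟩ :=
    ((frequently_lt_norm_pow_succ s H (hw n) ha0 ha2).and_eventually hsmall).exists
  have hxm : 0 < x m := pos_of_mul_pos_right ((pow_pos ha0 m).trans_le (hlow m)) hN0.le
  set f := (s.mulOp H ^ m) s.one with hf
  have hnc : ‖((x m : ℝ) : ℂ)⁻¹‖ = (x m)⁻¹ := by
    rw [norm_inv, Complex.norm_real, Real.norm_of_nonneg hxm.le]
  have hfz : ∀ z ∈ disc, ‖f z‖ = ‖H.1 z‖ ^ m := by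
    intro z hz
    rw [hf, pow_mulOp_apply, s.one_apply hz, mul_one, norm_pow]
  -- The vector is u = H^m/‖H^m‖. Since |H| ≤ |g|, the norm of M_g u is at least that of M_H u, the
  -- ratio of consecutive norms.
  refine ⟨((x m : ℝ) : ℂ)⁻¹ • f, ?_, ⟨(x m)⁻¹ * S ^ m, fun z => ?_⟩, fun z hz => ?_, ?_⟩
  · rw [norm_smul, hnc]
    exact inv_mul_cancel₀ hxm.ne'
  · rw [smul_apply, norm_mul, hnc]
    refine mul_le_mul_of_nonneg_left ?_ (by positivity)
    by_cases hz : z ∈ disc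
    · rw [hfz z hz]
      exact pow_le_pow_left₀ (norm_nonneg _) ((hHg z).trans (hg z)) m
    · rw [f.apply_eq_zero hz, norm_zero]
      positivity
  · rw [smul_apply, norm_mul, hnc, hfz z hz.1, inv_mul_le_iff₀ hxm, mul_comm]
    exact (pow_le_pow_left₀ (norm_nonneg _) (hoff z hz) m).trans hm2
  · have h1 : ‖s.mulOp H (((x m : ℝ) : ℂ)⁻¹ • f)‖ ≤ ‖s.mulOp g (((x m : ℝ) : ℂ)⁻¹ • f)‖ := by
      refine norm_mono fun z => ?_
      rw [mulOp_apply, mulOp_apply, norm_mul, norm_mul]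
      exact mul_le_mul_of_nonneg_right (hHg z) (norm_nonneg _)
    have h2 : s.mulOp H f = (s.mulOp H ^ (m + 1)) s.one := by
      rw [pow_succ']
      rfl
    rw [map_smul, norm_smul, hnc, h2] at h1
    refine le_trans ?_ h1
    rw [inv_mul_eq_div, le_div_iff₀ hxm]
    refine le_trans (mul_le_mul_of_nonneg_right ?_ hxm.le) hm1
    exact (le_max_right _ _).trans ha1.le

end SpaceKind

/-- A bounded holomorphic function almost attains its supremum near some boundary point. -/
theorem HInfty.exists_boundary_point {g : HInfty} {S : ℝ} (hS : 0 < S)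
    (hg : IsLUB (range fun z => ‖g.1 z‖) S) :
    ∃ ξ : ℂ, ‖ξ‖ = 1 ∧ ∃ w : ℕ → ℂ, (∀ n, w n ∈ disc) ∧ Tendsto w atTop (𝓝 ξ) ∧
      Tendsto (fun n => ‖g.1 (w n)‖) atTop (𝓝 S) := by
  obtain ⟨v, -, -, hv, hvr⟩ := hg.exists_seq_monotone_tendsto (range_nonempty _)
  choose w hw using hvr
  have hwS : Tendsto (fun n => ‖g.1 (w n)‖) atTop (𝓝 S) := hv.congr fun n => (hw n).symm
  obtain ⟨N, hN⟩ := eventually_atTop.1 (hwS.eventually (lt_mem_nhds hS))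
  -- Functions vanish off the disc, so points where |g| is positive lie in it.
  have hwd : ∀ n, w (n + N) ∈ disc := by
    intro n
    by_contra hcon
    have := hN (n + N) (by omega)
    simp [g.2.1.2 _ hcon] at this
  obtain ⟨ξ, hξ, φ, hφ, hlim⟩ := (isCompact_closedBall (0 : ℂ) 1).tendsto_subseq
    fun n => Metric.ball_subset_closedBall (hwd n)
  have hlimS : Tendsto (fun n => ‖g.1 (w (φ n + N))‖) atTop (𝓝 S) :=
    hwS.comp ((tendsto_add_atTop_nat N).comp hφ.tendsto_atTop)
  rcases (show ‖ξ‖ ≤ 1 by simpa using hξ).eq_or_lt with h1 | h1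
  · exact ⟨ξ, h1, fun n => w (φ n + N), fun n => hwd _, hlim, hlimS⟩
  have hξd : ξ ∈ disc := by simpa using h1
  have hgd := g.2.1.1
  have hgξ : ‖g.1 ξ‖ = S :=
    tendsto_nhds_unique (((hgd.continuousOn.continuousAt
      (Metric.isOpen_ball.mem_nhds hξd)).norm.tendsto).comp hlim) hlimS
  -- An interior limit point would be a maximum point of |g|. Then |g| is constant, and any boundary
  -- point, here 1, will do.
  have hconst := Complex.norm_eqOn_of_isPreconnected_of_isMaxOn
    (convex_ball (0 : ℂ) 1).isPreconnected Metric.isOpen_ball hgd hξd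
    (fun z _ => by
      change ‖g.1 z‖ ≤ ‖g.1 ξ‖
      rw [hgξ]
      exact hg.1 ⟨z, rfl⟩)
  refine ⟨1, norm_one, fun n => ((1 - 1 / ((n : ℝ) + 1) : ℝ) : ℂ), ?_, ?_, ?_⟩
  · intro n
    have h0 : 0 < 1 / ((n : ℝ) + 1) := by positivity
    have h2 : 1 / ((n : ℝ) + 1) ≤ 1 := by
      rw [div_le_one (by positivity)]
      linarith [Nat.cast_nonneg (α := ℝ) n]
    rw [mem_ball_zero_iff, Complex.norm_real, Real.norm_of_nonneg (by linarith)]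
    linarith
  · have := (tendsto_one_div_add_atTop_nhds_zero_nat (𝕜 := ℝ)).const_sub 1
    rw [sub_zero] at this
    exact_mod_cast (Complex.continuous_ofReal.tendsto 1).comp this
  · refine tendsto_const_nhds.congr fun n => ?_
    rw [← hgξ]
    refine (hconst ?_).symm
    have h0 : 0 < 1 / ((n : ℝ) + 1) := by positivity
    have h2 : 1 / ((n : ℝ) + 1) ≤ 1 := by
      rw [div_le_one (by positivity)]
      linarith [Nat.cast_nonneg (α := ℝ) n]
    rw [mem_ball_zero_iff, Complex.norm_real, Real.norm_of_nonneg (by linarith)]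
    linarith

namespace SpaceKind

variable {s : SpaceKind}

theorem exists_concentratesAt_of_pos (s : SpaceKind) {g : HInfty} {S : ℝ} (hS : 0 < S)
    (hg : IsLUB (range fun z => ‖g.1 z‖) S) :
    ∃ (φ : ℕ → s.Space) (ξ : ℂ), ConcentratesAt φ ξ ∧
      Tendsto (fun n => ‖s.mulOp g (φ n)‖) atTop (𝓝 S) := by
  obtain ⟨ξ, hξ, w, hw, hwξ, hwS⟩ := HInfty.exists_boundary_point hS hg
  have hgS : ∀ z, ‖g.1 z‖ ≤ S := fun z => hg.1 ⟨z, rfl⟩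
  have hpos : ∀ n : ℕ, 0 < 1 / ((n : ℝ) + 1) := fun n => by positivity
  choose φ h1 h2 h3 h4 using fun n : ℕ =>
    exists_concentrated s hS hgS hξ hw hwξ hwS (hpos n)
  refine ⟨φ, ξ, ⟨hξ, h1, h2, fun ε hε δ hδ => ?_⟩, ?_⟩
  · have ht := tendsto_one_div_add_atTop_nhds_zero_nat (𝕜 := ℝ)
    filter_upwards [ht.eventually (gt_mem_nhds hε), ht.eventually (gt_mem_nhds hδ)] with n a b z hz
    exact (h3 n z ⟨hz.1, fun hz' => hz.2 (Metric.ball_subset_ball a.le hz')⟩).trans b.le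
  · have ht := (tendsto_one_div_add_atTop_nhds_zero_nat (𝕜 := ℝ)).const_sub S
    rw [sub_zero] at ht
    refine tendsto_of_tendsto_of_tendsto_of_le_of_le ht tendsto_const_nhds h4 fun n => ?_
    simpa [h1 n] using norm_mulOp_le hgS (φ n)

/-- For every `g ∈ H^∞`, concentrated unit vectors along which `‖M_g φ_n‖ → ‖g‖_∞`. -/
theorem exists_concentratesAt (s : SpaceKind) (g : HInfty) :
    ∃ (φ : ℕ → s.Space) (ξ : ℂ), ConcentratesAt φ ξ ∧
      Tendsto (fun n => ‖s.mulOp g (φ n)‖ₑ) atTop (𝓝 (⨆ z, ‖g.1 z‖ₑ)) := by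
  obtain ⟨C, hC⟩ := HInfty.exists_bound g
  have hbdd : BddAbove (range fun z => ‖g.1 z‖) := ⟨C, by
    rintro _ ⟨z, rfl⟩
    simpa using hC z 1⟩
  have hlub := isLUB_ciSup hbdd
  set S := ⨆ z, ‖g.1 z‖ with hSdef
  have hgS : ∀ z, ‖g.1 z‖ ≤ S := fun z => hlub.1 ⟨z, rfl⟩
  have hS : (⨆ z, ‖g.1 z‖ₑ) = ENNReal.ofReal S := by
    have hle : (⨆ z, ‖g.1 z‖ₑ) ≤ ENNReal.ofReal S := iSup_le fun z => by
      rw [← ofReal_norm]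
      exact ENNReal.ofReal_le_ofReal (hgS z)
    have hne := ne_top_of_le_ne_top ENNReal.ofReal_ne_top hle
    refine le_antisymm hle (ENNReal.ofReal_le_of_le_toReal (hlub.2 ?_))
    rintro _ ⟨z, rfl⟩
    change ‖g.1 z‖ ≤ _
    rw [← toReal_enorm]
    exact ENNReal.toReal_mono hne (le_iSup (fun z => ‖g.1 z‖ₑ) z)
  rcases (norm_nonneg _ |>.trans (hgS 0)).eq_or_lt with h0 | h0
  -- When g = 0 there is nothing to norm, but a concentrating sequence is still required; one built
  -- for the constant 1 serves.
  · obtain ⟨φ, ξ, hφ, -⟩ := s.exists_concentratesAt_of_pos (g := HInfty.one) one_pos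
      ⟨by
        rintro _ ⟨z, rfl⟩
        by_cases hz : z ∈ disc
        · simp [HInfty.one_apply hz]
        · simp [HInfty.one.2.1.2 z hz], fun b hb => by
        have := hb ⟨0, rfl⟩
        simpa [HInfty.one_apply (z := 0) (by simp)] using this⟩
    refine ⟨φ, ξ, hφ, ?_⟩
    rw [hS, ← h0, ENNReal.ofReal_zero]
    refine tendsto_const_nhds.congr fun n => ?_
    refine (nonpos_iff_eq_zero.1 ((enorm_mulOp_le (C := 0) (fun z => ?_) _).trans_eq
      (zero_mul _))).symm
    rw [← ofReal_norm]
    exact (ENNReal.ofReal_le_ofReal (hgS z)).trans_eq (by rw [← h0, ENNReal.ofReal_zero])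
  · obtain ⟨φ, ξ, hφ, ht⟩ := s.exists_concentratesAt_of_pos h0 hlub
    refine ⟨φ, ξ, hφ, ?_⟩
    rw [hS]
    simpa only [Function.comp_def, ofReal_norm] using (ENNReal.continuous_ofReal.tendsto S).comp ht

/-- `EN` of a multiplication operator is the supremum of its symbol. -/
theorem EN_mulOp (s : SpaceKind) (g : HInfty) : EN (s.mulOp g) = ⨆ z, ‖g.1 z‖ₑ := by
  refine le_antisymm (iSup₂_le fun f hf => ?_) ?_
  · refine limsup_le_of_le (by isBoundedDefault) (Eventually.of_forall fun n => ?_)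
    refine (enorm_mulOp_le (fun z => le_iSup (fun z => ‖g.1 z‖ₑ) z) (f n)).trans_eq ?_
    rw [← ofReal_norm, hf.1 n, ENNReal.ofReal_one, mul_one]
  · obtain ⟨φ, ξ, hφ, ht⟩ := s.exists_concentratesAt g
    rw [← ht.limsup_eq]
    exact le_iSup₂ (f := fun (f : ℕ → s.Space) (_ : IsWeaklyNullUnit f) =>
      limsup (fun n => ‖s.mulOp g (f n)‖ₑ) atTop) φ hφ.isWeaklyNullUnit

end SpaceKind

/-- Because a_n ≤ b, convergence of the integrals is convergence of b - a_n to 0 in L¹. Along a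
subsequence these integrals are at most 2^(-n), so the series of differences is finite almost
everywhere and its terms tend to 0. -/
theorem exists_subseq_ae_tendsto_of_tendsto_lintegral {Ω : Type*} [MeasurableSpace Ω]
    {μ : Measure Ω} {a : ℕ → Ω → ℝ≥0∞} {b : Ω → ℝ≥0∞} (ha : ∀ n, AEMeasurable (a n) μ)
    (hb : AEMeasurable b μ) (hab : ∀ n x, a n x ≤ b x) (hfin : ∫⁻ x, b x ∂μ ≠ ∞)
    (hlim : Tendsto (fun n => ∫⁻ x, a n x ∂μ) atTop (𝓝 (∫⁻ x, b x ∂μ))) :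
    ∃ k : ℕ → ℕ, StrictMono k ∧ ∀ᵐ x ∂μ, Tendsto (fun n => a (k n) x) atTop (𝓝 (b x)) := by
  have hd : ∀ n, ∫⁻ x, (b x - a n x) ∂μ = ∫⁻ x, b x ∂μ - ∫⁻ x, a n x ∂μ := fun n =>
    lintegral_sub' (ha n) (ne_top_of_le_ne_top hfin (lintegral_mono (hab n)))
      (ae_of_all _ (hab n))
  have h0 : Tendsto (fun n => ∫⁻ x, (b x - a n x) ∂μ) atTop (𝓝 0) := by
    simp only [hd]
    simpa using ENNReal.Tendsto.sub tendsto_const_nhds hlim (Or.inl hfin)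
  obtain ⟨k, hk, hk2⟩ := extraction_forall_of_eventually' (P := fun n m =>
    ∫⁻ x, (b x - a m x) ∂μ ≤ (2⁻¹ : ℝ≥0∞) ^ n) fun n => by
      obtain ⟨N, hN⟩ := eventually_atTop.1 (ENNReal.tendsto_nhds_zero.1 h0 ((2⁻¹ : ℝ≥0∞) ^ n)
        (pos_iff_ne_zero.2 (pow_ne_zero _ (by simp))))
      exact ⟨N, hN⟩
  refine ⟨k, hk, ?_⟩
  have hm : ∀ n, AEMeasurable (fun x => b x - a (k n) x) μ := fun n => hb.sub (ha (k n))
  have hsum : ∫⁻ x, ∑' n, (b x - a (k n) x) ∂μ ≠ ∞ := by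
    rw [lintegral_tsum hm]
    refine ne_top_of_le_ne_top ?_ (ENNReal.tsum_le_tsum hk2)
    rw [ENNReal.tsum_geometric]
    simp
  filter_upwards [ae_lt_top' (AEMeasurable.tsum hm) hsum,
    ae_lt_top' hb hfin] with x hx hbx
  have ht := ENNReal.tendsto_atTop_zero_of_tsum_ne_top hx.ne
  have h1 := ENNReal.Tendsto.sub (tendsto_const_nhds (x := b x)) ht (Or.inl hbx.ne)
  rw [tsub_zero] at h1
  refine h1.congr fun n => ?_
  exact ENNReal.sub_sub_cancel hbx.ne (hab _ x)

/-! ### The integral as a multiplication operator -/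

namespace SpaceKind

variable {s : SpaceKind} {g : ℝ → HInfty}

/-- Point evaluations are bounded functionals, so they commute with the Bochner integral. The symbol
is the image of the constant function 1. -/
theorem integralOp_mulOp_apply (hW : ConditionW fun t => s.mulOp (g t)) (f : s.Space) (z : ℂ) :
    integralOp (fun t => s.mulOp (g t)) hW f z =
      integralOp (fun t => s.mulOp (g t)) hW s.one z * f z := by
  have key : ∀ h : s.Space, integralOp (fun t => s.mulOp (g t)) hW h z =
      ∫ t in Ioo (0 : ℝ) 1, (g t).1 z * h z := fun h =>
    ((s.eval z).integral_comp_comm (hW.integrable h)).symm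
  by_cases hz : z ∈ disc
  · rw [key, key, ← integral_mul_const, s.one_apply hz]
    simp only [mul_one]
  · rw [Space.apply_eq_zero _ hz, Space.apply_eq_zero _ hz, zero_mul]

/-- A bounded operator that acts as multiplication by a function is a multiplication operator with
symbol in `H^∞`. -/
theorem exists_eq_mulOp {T : s.Space →L[ℂ] s.Space} (hT : ∀ f z, T f z = T s.one z * f z) :
    ∃ G : HInfty, T = s.mulOp G := by
  have hpow : ∀ (m : ℕ) (z : ℂ), z ∈ disc → (T ^ m) s.one z = T s.one z ^ m := by
    intro m z hz
    induction m with
    | zero => simpa using s.one_apply hz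
    | succ m ih =>
      rw [pow_succ']
      change T ((T ^ m) s.one) z = _
      rw [hT, ih, pow_succ']
  refine ⟨⟨T s.one, (T s.one).2.1, ‖T‖, fun z hz => ?_⟩, ContinuousLinearMap.ext fun f =>
    Space.ext fun z _ => hT f z⟩
  by_contra! hcon
  rcases (norm_nonneg T).eq_or_lt with h0 | h0
  · have : T = 0 := norm_eq_zero.1 h0.symm
    subst this
    rw [norm_zero] at hcon
    exact absurd hcon (not_lt.2 (norm_zero (E := ℂ)).le)
  -- The m-th power of the symbol at z is the value of T^m 1 there, hence at most a constant times
  -- ‖T‖^m. Letting m grow removes the constant.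
  have hb : ∀ m : ℕ, (‖T s.one z‖ / ‖T‖) ^ m ≤ ‖s.eval z‖ * ‖s.one‖ := by
    intro m
    rw [div_pow, div_le_iff₀ (by positivity), ← norm_pow, ← hpow m z hz]
    refine ((s.eval z).le_opNorm _).trans ?_
    rw [mul_assoc]
    refine mul_le_mul_of_nonneg_left (((T ^ m).le_opNorm _).trans ?_) (norm_nonneg _)
    rw [mul_comm]
    have : ‖T ^ m‖ ≤ ‖T‖ ^ m := by
      rcases m.eq_zero_or_pos with rfl | hm
      · rw [pow_zero, pow_zero]; exact ContinuousLinearMap.norm_id_le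
      · exact norm_pow_le' T hm
    gcongr
  obtain ⟨m, hm⟩ := pow_unbounded_of_one_lt (‖s.eval z‖ * ‖s.one‖) ((one_lt_div h0).2 hcon)
  exact (hb m).not_gt hm

/-- The supremum is over uncountably many z, so measurability comes from lower semicontinuity: each
t ↦ g_t(z) is continuous on (0,1), being the value at z of M_{g_t} applied to 1. -/
theorem aemeasurable_iSup_enorm (hW : ConditionW fun t => s.mulOp (g t)) :
    AEMeasurable (fun t => ⨆ z, ‖(g t).1 z‖ₑ) (volume.restrict (Ioo (0 : ℝ) 1)) := by
  refine aemeasurable_restrict_of_measurable_subtype measurableSet_Ioo ?_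
  refine LowerSemicontinuous.measurable (lowerSemicontinuous_iSup fun z => ?_)
  refine Continuous.lowerSemicontinuous (Continuous.enorm ?_)
  by_cases hz : z ∈ disc
  · have h1 : Continuous fun t : Ioo (0 : ℝ) 1 => s.mulOp (g t) s.one :=
      continuousOn_iff_continuous_domRestrict.1 (hW s.one).1
    refine ((s.eval z).continuous.comp h1).congr fun t => ?_
    change (g t).1 z * s.one z = _
    rw [s.one_apply hz, mul_one]
  · exact continuous_const.congr fun t => ((g t).2.1.2 z hz).symm

/-! ### The inequality between the two sides and the case of equality -/

theorem enorm_integralOp_le (hW : ConditionW fun t => s.mulOp (g t)) (f : s.Space) :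
    ‖integralOp (fun t => s.mulOp (g t)) hW f‖ₑ ≤ ∫⁻ t in Ioo (0 : ℝ) 1, ‖s.mulOp (g t) f‖ₑ :=
  enorm_integral_le_lintegral_enorm _

/-- For a multiplication operator EN is the supremum of the symbol, so it dominates ‖M_{g_t} f‖ for
every unit vector f, not merely asymptotically along weakly null sequences. -/
theorem lintegral_enorm_mulOp_le {f : s.Space} (hf : ‖f‖ = 1) :
    ∫⁻ t in Ioo (0 : ℝ) 1, ‖s.mulOp (g t) f‖ₑ ≤ ∫⁻ t in Ioo (0 : ℝ) 1, EN (s.mulOp (g t)) := by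
  refine lintegral_mono fun t => ?_
  rw [EN_mulOp]
  refine (enorm_mulOp_le (fun z => le_iSup (fun z => ‖(g t).1 z‖ₑ) z) f).trans_eq ?_
  rw [← ofReal_norm, hf, ENNReal.ofReal_one, mul_one]

theorem EN_integralOp_le (hW : ConditionW fun t => s.mulOp (g t)) :
    EN (integralOp (fun t => s.mulOp (g t)) hW) ≤ ∫⁻ t in Ioo (0 : ℝ) 1, EN (s.mulOp (g t)) :=
  iSup₂_le fun f hf => limsup_le_of_le (by isBoundedDefault) (Eventually.of_forall fun n =>
    (enorm_integralOp_le hW (f n)).trans (lintegral_enorm_mulOp_le (hf.1 n)))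

/-- By (I2) the right-hand side is the integral of a lower limit, to which Fatou's lemma applies;
(I1) then replaces the integral of norms by the norm of the integral. -/
theorem EN_integralOp_eq_of_conditions (hW : ConditionW fun t => s.mulOp (g t)) {φ : ℕ → s.Space}
    (hφ : IsWeaklyNullUnit φ) (h1 : CondI1 (fun t => s.mulOp (g t)) φ)
    (h2 : CondI2 (fun t => s.mulOp (g t)) φ) :
    EN (integralOp (fun t => s.mulOp (g t)) hW) = ∫⁻ t in Ioo (0 : ℝ) 1, EN (s.mulOp (g t)) := by
  refine le_antisymm (EN_integralOp_le hW) ?_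
  obtain ⟨L, hL1, hL2⟩ := h1
  have e1 : Tendsto (fun n => ‖integralOp (fun t => s.mulOp (g t)) hW (φ n)‖ₑ) atTop
      (𝓝 (ENNReal.ofReal L)) := by
    refine ((ENNReal.continuous_ofReal.tendsto L).comp hL1).congr fun n => ?_
    exact ofReal_norm _
  have e2 : Tendsto (fun n => ∫⁻ t in Ioo (0 : ℝ) 1, ‖s.mulOp (g t) (φ n)‖ₑ) atTop
      (𝓝 (ENNReal.ofReal L)) := by
    refine ((ENNReal.continuous_ofReal.tendsto L).comp hL2).congr fun n => ?_
    exact ofReal_integral_norm_eq_lintegral_enorm (hW.integrable (φ n))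
  calc ∫⁻ t in Ioo (0 : ℝ) 1, EN (s.mulOp (g t))
      = ∫⁻ t in Ioo (0 : ℝ) 1, liminf (fun n => ‖s.mulOp (g t) (φ n)‖ₑ) atTop :=
        lintegral_congr_ae (h2.mono fun t ht => ht.symm)
    _ ≤ liminf (fun n => ∫⁻ t in Ioo (0 : ℝ) 1, ‖s.mulOp (g t) (φ n)‖ₑ) atTop :=
        lintegral_liminf_le' fun n => (hW.integrable (φ n)).1.enorm
    _ = ENNReal.ofReal L := e2.liminf_eq
    _ = limsup (fun n => ‖integralOp (fun t => s.mulOp (g t)) hW (φ n)‖ₑ) atTop :=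
        e1.limsup_eq.symm
    _ ≤ _ := le_iSup₂ (f := fun (f : ℕ → s.Space) (_ : IsWeaklyNullUnit f) =>
        limsup (fun n => ‖integralOp (fun t => s.mulOp (g t)) hW (f n)‖ₑ) atTop) φ hφ

theorem ConcentratesAt.comp {φ : ℕ → s.Space} {ξ : ℂ} (h : ConcentratesAt φ ξ) {k : ℕ → ℕ}
    (hk : StrictMono k) : ConcentratesAt (φ ∘ k) ξ :=
  ⟨h.norm_point, fun n => h.norm_eq (k n), fun n => h.bounded (k n), fun ε hε δ hδ =>
    hk.tendsto_atTop.eventually (h.small ε hε δ hδ)⟩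

theorem exists_of_EN_integralOp_eq (hW : ConditionW fun t => s.mulOp (g t))
    (h : EN (integralOp (fun t => s.mulOp (g t)) hW) =
      ∫⁻ t in Ioo (0 : ℝ) 1, EN (s.mulOp (g t))) :
    ∃ φ : ℕ → s.Space, IsApproxEvaluation φ ∧ IsWeaklyNullUnit φ ∧
      CondI1 (fun t => s.mulOp (g t)) φ ∧ CondI2 (fun t => s.mulOp (g t)) φ := by
  obtain ⟨G, hG⟩ := exists_eq_mulOp (integralOp_mulOp_apply hW)
  obtain ⟨φ, ξ, hφ, ht⟩ := s.exists_concentratesAt G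
  rw [← EN_mulOp, ← hG, h] at ht
  set I := ∫⁻ t in Ioo (0 : ℝ) 1, EN (s.mulOp (g t)) with hI
  -- The right-hand side may be infinite in general; here the equality forces it to be finite,
  -- because G is bounded.
  have hItop : I ≠ ∞ := by
    rw [← h, hG, EN_mulOp]
    obtain ⟨C, hC⟩ := HInfty.exists_bound G
    refine ne_top_of_le_ne_top (ENNReal.ofReal_ne_top (r := C)) (iSup_le fun z => ?_)
    rw [← ofReal_norm]
    exact ENNReal.ofReal_le_ofReal (by simpa using hC z 1)
  have ht2 : Tendsto (fun n => ∫⁻ t in Ioo (0 : ℝ) 1, ‖s.mulOp (g t) (φ n)‖ₑ) atTop (𝓝 I) :=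
    tendsto_of_tendsto_of_tendsto_of_le_of_le ht tendsto_const_nhds
      (fun n => enorm_integralOp_le hW (φ n))
      fun n => lintegral_enorm_mulOp_le (hφ.norm_eq n)
  obtain ⟨k, hk, hae⟩ := exists_subseq_ae_tendsto_of_tendsto_lintegral
    (fun n => (hW.integrable (φ n)).1.enorm)
    ((aemeasurable_iSup_enorm hW).congr (ae_of_all _ fun t => (EN_mulOp s (g t)).symm))
    (fun n t => by
      rw [EN_mulOp]
      refine (enorm_mulOp_le (fun z => le_iSup (fun z => ‖(g t).1 z‖ₑ) z) (φ n)).trans_eq ?_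
      rw [← ofReal_norm, hφ.norm_eq n, ENNReal.ofReal_one, mul_one]) hItop ht2
  have hφk := hφ.comp hk
  refine ⟨φ ∘ k, hφk.isApproxEvaluation, hφk.isWeaklyNullUnit, ⟨I.toReal, ?_, ?_⟩, ?_⟩
  · refine ((ENNReal.tendsto_toReal hItop).comp (ht.comp hk.tendsto_atTop)).congr fun n => ?_
    exact toReal_enorm _
  · refine ((ENNReal.tendsto_toReal hItop).comp (ht2.comp hk.tendsto_atTop)).congr fun n => ?_
    exact (integral_norm_eq_lintegral_enorm (hW.integrable _).1).symm
  -- Along the subsequence the norms converge to EN(M_{g_t}) for almost every t, which is more than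
  -- the lower limit in (I2).
  · exact hae.mono fun t h => h.liminf_eq

end SpaceKind
end DiscSpaces

theorem mainTheorem1 (X : SpaceKind) (g : ℝ → HInfty)
    (hW : ConditionW (fun t => X.mulOp (g t))) :
    (EN (integralOp (fun t => X.mulOp (g t)) hW) = ∫⁻ t in Ioo (0 : ℝ) 1, EN (X.mulOp (g t)) ↔
      ∃ φ : ℕ → X.Space, IsWeaklyNullUnit φ ∧
        CondI1 (fun t => X.mulOp (g t)) φ ∧ CondI2 (fun t => X.mulOp (g t)) φ) ∧
    (EN (integralOp (fun t => X.mulOp (g t)) hW) = ∫⁻ t in Ioo (0 : ℝ) 1, EN (X.mulOp (g t)) →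
      ∃ φ : ℕ → X.Space, IsApproxEvaluation φ ∧ IsWeaklyNullUnit φ ∧
        CondI1 (fun t => X.mulOp (g t)) φ ∧ CondI2 (fun t => X.mulOp (g t)) φ) := by
  refine ⟨⟨fun h => ?_, ?_⟩, SpaceKind.exists_of_EN_integralOp_eq hW⟩
  · obtain ⟨φ, -, hφ⟩ := SpaceKind.exists_of_EN_integralOp_eq hW h
    exact ⟨φ, hφ⟩
  · rintro ⟨φ, hφ, h1, h2⟩
    exact SpaceKind.EN_integralOp_eq_of_conditions hW hφ h1 h2
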